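/- All graphs are finite and simple. For a graph $G$, write $|G|$, $\delta(G)$ and $\alpha(G)$ for its number of vertices, its minimum degree and its independence number (the maximum size of a set of pairwise non-adjacent vertices). An orientation of $G$ is a digraph $D$ obtained from $G$ by replacing each edge by exactly one of its two possible arcs. If $D$ has $m$ arcs and $\tau$ is a bijection from the arc set of $D$ to $\{1,\dots,m\}$, the vertex-sum of a vertex $u$ is the sum of the labels $\tau(e)$ of all arcs $e$ entering $u$ minus the sum of the labels of all arcs leaving $u$ (so it is $0$ if $u$ is isolated). We say that $G$ has an antimagic orientation if there are an orientation $D$ of $G$ and such a bijection $\tau$ for which distinct vertices have distinct vertex-sums. **Theorem 1.5.** Let $G$ be a connected graph. (i) If $\alpha(G)\le 2$, then $G$ has an antimagic orientation. (ii) If $\alpha(G)=3$ and $|G|\ge 13$, then $G$ has an antimagic orientation. (iii) If $\alpha(G)=4$ and $\delta(G)\ge 11$, then $G$ has an antimagic orientation. -/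

import Mathlib

/-- The set of arcs of a digraph; the pair `(u, v)` is the arc leaving `u` and entering `v`. -/
def Digraph.arcs {V : Type*} (D : Digraph V) : Set (V × V) :=
  {p | D.Adj p.1 p.2}

open Classical in
/-- The vertex-sum of `u` in `D` under the arc labeling `τ`: the sum of the labels of all arcs
entering `u` minus the sum of the labels of all arcs leaving `u`, as an integer. Only the values
of `τ` on the arcs of `D` matter; the vertex-sum of an isolated vertex is `0` (empty sums). -/
noncomputable def Digraph.vertexSum {V : Type*} [Fintype V] (D : Digraph V) (τ : V × V → ℕ)
    (u : V) : ℤ :=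
  (∑ v : V with D.Adj v u, (τ (v, u) : ℤ)) - ∑ v : V with D.Adj u v, (τ (u, v) : ℤ)

/-- `τ` is an antimagic labeling of the digraph `D` with `m` arcs: it restricts to a bijection from
the arcs of `D` onto `{1, …, m}`, and distinct vertices have distinct vertex-sums. -/
def Digraph.IsAntimagicLabeling {V : Type*} [Fintype V] (D : Digraph V) (τ : V × V → ℕ) : Prop :=
  Set.BijOn τ D.arcs (Set.Icc 1 D.arcs.ncard) ∧
    ∀ u v : V, u ≠ v → D.vertexSum τ u ≠ D.vertexSum τ v

/-- `D` is an orientation of the simple graph `G`: it has the vertices of `G`, every edge of `G`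
gives an arc in exactly one of its two directions, and there are no other arcs. -/
def SimpleGraph.IsOrientation {V : Type*} (G : SimpleGraph V) (D : Digraph V) : Prop :=
  (∀ u v : V, G.Adj u v ↔ D.Adj u v ∨ D.Adj v u) ∧ ∀ u v : V, D.Adj u v → ¬ D.Adj v u

/-- `G` has an antimagic orientation: some orientation of `G` has an antimagic labeling. -/
def SimpleGraph.HasAntimagicOrientation {V : Type*} [Fintype V] (G : SimpleGraph V) : Prop :=
  ∃ (D : Digraph V) (τ : V × V → ℕ), G.IsOrientation D ∧ D.IsAntimagicLabeling τ

/-! Let `S` be an independent dominating set of `G`; one exists whose members are joined by a tree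
of common neighbours. Orient all edges at `S` away from `S`, so the sums in `S` are not positive.
Every vertex outside `S` receives one large label on an arc from `S`; handing these out in
increasing order of the remaining sums makes the sums outside `S` positive and distinct.

To separate the sums in `S`, exchange the labels of two arcs from `S` into a common neighbour: this
changes the sums of the two tails and no others. A labeling that maximizes the sum of squares over
`S` cannot have equal sums at two vertices with a common neighbour. When `S` has three or four
vertices, further coincidences are possible, and they are removed by a few more exchanges; these
work since the amounts exchanged at different common neighbours are arranged beforehand to be of
clearly different sizes, for which `G` needs enough edges. These are supplied by Turán's theorem
and by the minimum degree. -/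

namespace AntimagicOrientation

open SimpleGraph

/-- An oriented and labeled graph, encoded by one function: `g u v` is the label of the arc from
`u` to `v`, and `0` if there is no such arc. The arcs form an orientation of `G` and are labeled
bijectively by `L`. -/
structure IsLabeling {V : Type*} (G : SimpleGraph V) (L : Finset ℕ) (g : V → V → ℕ) : Prop where
  adj_iff (u v : V) : G.Adj u v ↔ g u v ≠ 0 ∨ g v u ≠ 0
  asymm (u v : V) : g u v ≠ 0 → g v u = 0
  bijOn : Set.BijOn (Function.uncurry g) (Function.support (Function.uncurry g)) L

/-- The vertex-sum of `u`, for an arc labeling encoded as in `IsLabeling`. -/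
def netSum {V : Type*} [Fintype V] (g : V → V → ℕ) (u : V) : ℤ :=
  ∑ v, ((g v u : ℤ) - g u v)

section Labeling

variable {V : Type*} {G G₁ G₂ : SimpleGraph V} {L L₁ L₂ : Finset ℕ} {g g₁ g₂ : V → V → ℕ}

theorem IsLabeling.mem_of_ne_zero (h : IsLabeling G L g) {u v : V} (huv : g u v ≠ 0) :
    g u v ∈ L :=
  h.bijOn.mapsTo (x := (u, v)) huv

theorem IsLabeling.eq_zero_of_not_adj (h : IsLabeling G L g) {u v : V} (huv : ¬ G.Adj u v) :
    g u v = 0 := by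
  by_contra hne
  exact huv ((h.adj_iff u v).2 (Or.inl hne))

theorem IsLabeling.sup (h₁ : IsLabeling G₁ L₁ g₁) (h₂ : IsLabeling G₂ L₂ g₂)
    (hG : Disjoint G₁ G₂) (hL : Disjoint L₁ L₂) :
    IsLabeling (G₁ ⊔ G₂) (L₁ ∪ L₂) (g₁ + g₂) := by
  have hzero (u v : V) : g₁ u v = 0 ∧ g₁ v u = 0 ∨ g₂ u v = 0 ∧ g₂ v u = 0 := by
    by_cases huv : G₁.Adj u v
    · have huv₂ := SimpleGraph.disjoint_left.1 hG u v huv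
      exact Or.inr ⟨h₂.eq_zero_of_not_adj huv₂, h₂.eq_zero_of_not_adj (huv₂ ∘ Adj.symm)⟩
    · exact Or.inl ⟨h₁.eq_zero_of_not_adj huv, h₁.eq_zero_of_not_adj (huv ∘ Adj.symm)⟩
  have heq₁ : Set.EqOn (Function.uncurry g₁) (Function.uncurry (g₁ + g₂))
      (Function.support (Function.uncurry g₁)) := fun p hp => by
    simp only [Function.mem_support, Function.uncurry, Pi.add_apply] at hp ⊢
    grind
  have heq₂ : Set.EqOn (Function.uncurry g₂) (Function.uncurry (g₁ + g₂))
      (Function.support (Function.uncurry g₂)) := fun p hp => by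
    simp only [Function.mem_support, Function.uncurry, Pi.add_apply] at hp ⊢
    grind
  have hsupp : Function.support (Function.uncurry (g₁ + g₂)) =
      Function.support (Function.uncurry g₁) ∪ Function.support (Function.uncurry g₂) := by
    ext p
    simp only [Function.mem_support, Set.mem_union, Function.uncurry, Pi.add_apply]
    omega
  have hbij₁ := h₁.bijOn.congr heq₁
  have hbij₂ := h₂.bijOn.congr heq₂
  refine ⟨fun u v => ?_, fun u v huv => ?_, ?_⟩
  · rw [sup_adj, h₁.adj_iff, h₂.adj_iff]
    simp only [Pi.add_apply]
    omega
  · have := h₁.asymm u v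
    have := h₂.asymm u v
    have := hzero u v
    simp only [Pi.add_apply] at huv ⊢
    omega
  · have hdisj := Finset.disjoint_coe.2 hL
    rw [hsupp, Finset.coe_union]
    refine hbij₁.union hbij₂ ((Set.injOn_union ?_).2 ⟨hbij₁.injOn, hbij₂.injOn, ?_⟩)
    · exact Set.disjoint_left.2 fun p hp₁ hp₂ =>
        Set.disjoint_left.1 hdisj (hbij₁.mapsTo hp₁) (hbij₂.mapsTo hp₂)
    · exact fun p hp q hq => hdisj.ne_of_mem (hbij₁.mapsTo hp) (hbij₂.mapsTo hq)

variable [Fintype V]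

theorem netSum_add (g₁ g₂ : V → V → ℕ) (u : V) :
    netSum (g₁ + g₂) u = netSum g₁ u + netSum g₂ u := by
  simp only [netSum, Pi.add_apply, ← Finset.sum_add_distrib]
  exact Finset.sum_congr rfl fun v _ => by push_cast; ring

theorem vertexSum_eq_netSum (g : V → V → ℕ) (u : V) :
    Digraph.vertexSum ⟨fun a b => g a b ≠ 0⟩ (Function.uncurry g) u = netSum g u := by
  simp only [Digraph.vertexSum, netSum, Function.uncurry, Finset.sum_sub_distrib]
  congr 1 <;>
  · refine Finset.sum_filter_of_ne fun v _ hv => ?_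
    exact_mod_cast hv

theorem IsLabeling.hasAntimagicOrientation {N : ℕ} (h : IsLabeling G (Finset.Icc 1 N) g)
    (hinj : Function.Injective (netSum g)) : G.HasAntimagicOrientation := by
  refine ⟨⟨fun u v => g u v ≠ 0⟩, Function.uncurry g, ⟨h.adj_iff, fun u v huv => ?_⟩, ?_, ?_⟩
  · exact not_not_intro (h.asymm u v huv)
  · have hcard : (Function.support (Function.uncurry g)).ncard = N := by
      rw [← h.bijOn.injOn.ncard_image, h.bijOn.image_eq, Set.ncard_coe_finset, Nat.card_Icc,
        Nat.add_sub_cancel]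
    have hbij := h.bijOn
    rw [Finset.coe_Icc, ← hcard] at hbij
    exact hbij
  · intro u v huv
    rw [vertexSum_eq_netSum, vertexSum_eq_netSum]
    exact hinj.ne huv

end Labeling

section Arcs

variable {V : Type*} {E : Finset (V × V)} {ℓ : V × V → ℕ}

/-- The graph whose edges are the pairs in `E`, which stand for arcs of an orientation. -/
def arcGraph (E : Finset (V × V)) : SimpleGraph V :=
  SimpleGraph.fromRel fun u v => (u, v) ∈ E

/-- The labeling, encoded as in `IsLabeling`, that gives the arc `p ∈ E` the label `ℓ p`. -/
noncomputable def arcLabeling (E : Finset (V × V)) (ℓ : V × V → ℕ) (u v : V) : ℕ :=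
  (E : Set (V × V)).indicator ℓ (u, v)

theorem arcLabeling_of_mem {u v : V} (h : (u, v) ∈ E) : arcLabeling E ℓ u v = ℓ (u, v) :=
  Set.indicator_of_mem (Finset.mem_coe.2 h) ℓ

theorem arcLabeling_of_notMem {u v : V} (h : (u, v) ∉ E) : arcLabeling E ℓ u v = 0 :=
  Set.indicator_of_notMem (mt Finset.mem_coe.1 h) ℓ

theorem arcGraph_adj (hE : ∀ p ∈ E, p.swap ∉ E) {u v : V} :
    (arcGraph E).Adj u v ↔ (u, v) ∈ E ∨ (v, u) ∈ E := by
  refine (SimpleGraph.fromRel_adj _ u v).trans (and_iff_right_of_imp ?_)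
  rintro h rfl
  exact hE (u, u) (h.elim id id) (h.elim id id)

theorem isLabeling_arcGraph (hE : ∀ p ∈ E, p.swap ∉ E) (hℓ : Set.InjOn ℓ E)
    (hpos : ∀ p ∈ E, ℓ p ≠ 0) : IsLabeling (arcGraph E) (E.image ℓ) (arcLabeling E ℓ) := by
  have hne {u v : V} : arcLabeling E ℓ u v ≠ 0 ↔ (u, v) ∈ E :=
    ⟨not_imp_comm.1 arcLabeling_of_notMem, fun h => by
      rw [arcLabeling_of_mem h]; exact hpos _ h⟩
  have hsupp : Function.support (Function.uncurry (arcLabeling E ℓ)) = E := by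
    ext p
    exact hne
  refine ⟨fun u v => by rw [arcGraph_adj hE, hne, hne], fun u v huv => ?_, ?_⟩
  · exact arcLabeling_of_notMem (hE _ (hne.1 huv))
  · rw [hsupp, Finset.coe_image]
    exact hℓ.bijOn_image.congr fun p hp => (arcLabeling_of_mem hp).symm

theorem ncard_edgeSet_arcGraph (hE : ∀ p ∈ E, p.swap ∉ E) :
    (arcGraph E).edgeSet.ncard = E.card := by
  have himage : (arcGraph E).edgeSet = Sym2.mk.uncurry '' (E : Set (V × V)) := by
    ext e
    induction e with | _ u v
    simp only [mem_edgeSet, arcGraph_adj hE, Set.mem_image, Finset.mem_coe, Prod.exists,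
      Function.uncurry, Sym2.eq_iff]
    grind
  have hinj : Set.InjOn Sym2.mk.uncurry (E : Set (V × V)) := fun p hp q hq hpq => by
    rcases Sym2.mk_eq_mk_iff.1 hpq with h | h
    · exact h
    · exact (hE q hq (h ▸ hp)).elim
  rw [himage, hinj.ncard_image, Set.ncard_coe_finset]

theorem arcGraph_le {G : SimpleGraph V} (hE : ∀ p ∈ E, G.Adj p.1 p.2) : arcGraph E ≤ G :=
  fun u v huv => by
    obtain ⟨-, h | h⟩ := (SimpleGraph.fromRel_adj _ u v).1 huv
    · exact hE _ h
    · exact (hE _ h).symm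

theorem ncard_edgeSet_sdiff_arcGraph [Finite V] {G : SimpleGraph V} (hE : ∀ p ∈ E, p.swap ∉ E)
    (hle : arcGraph E ≤ G) : (G \ arcGraph E).edgeSet.ncard + E.card = G.edgeSet.ncard := by
  rw [← ncard_edgeSet_arcGraph hE, edgeSet_sdiff,
    Set.ncard_sdiff_add_ncard_of_subset (edgeSet_mono hle)]

theorem IsLabeling.add_arcLabeling {G : SimpleGraph V} {L : Finset ℕ} {f : V → V → ℕ}
    (hf : IsLabeling (G \ arcGraph E) L f) (hE : ∀ p ∈ E, p.swap ∉ E) (hle : arcGraph E ≤ G)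
    (hℓ : Set.InjOn ℓ E) (hpos : ∀ p ∈ E, ℓ p ≠ 0) (hL : ∀ p ∈ E, ℓ p ∉ L) :
    IsLabeling G (L ∪ E.image ℓ) (f + arcLabeling E ℓ) := by
  have hdisj : Disjoint L (E.image ℓ) := by
    rw [Finset.disjoint_right]
    exact Finset.forall_mem_image.2 hL
  simpa only [sdiff_sup_cancel hle] using
    hf.sup (isLabeling_arcGraph hE hℓ hpos) disjoint_sdiff_self_left hdisj

theorem netSum_arcLabeling_nonneg [Fintype V] {v : V} (hv : ∀ p ∈ E, p.1 ≠ v) :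
    0 ≤ netSum (arcLabeling E ℓ) v := by
  refine Finset.sum_nonneg fun u _ => ?_
  rw [arcLabeling_of_notMem fun h => hv _ h rfl]
  simp

theorem netSum_arcLabeling_singleton [Fintype V] [DecidableEq V] (a b : V) :
    netSum (arcLabeling {(a, b)} ℓ) = Pi.single b (ℓ (a, b) : ℤ) - Pi.single a (ℓ (a, b) : ℤ) := by
  ext u
  have harc (v w : V) :
      arcLabeling {(a, b)} ℓ v w = if v = a ∧ w = b then ℓ (a, b) else 0 := by
    simp only [arcLabeling, Set.indicator_apply, Finset.coe_singleton, Set.mem_singleton_iff,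
      Prod.mk.injEq]
    grind
  simp only [netSum, harc, Finset.sum_sub_distrib, Pi.sub_apply, Pi.single_apply]
  simp [ite_and]

end Arcs

section Greedy

variable {V : Type*} {G : SimpleGraph V}

theorem exists_adj_of_ncard_edgeSet_pos (h : 0 < G.edgeSet.ncard) : ∃ b a, G.Adj b a := by
  rw [← ne_bot_iff_exists_adj, ← edgeSet_nonempty]
  exact Set.nonempty_of_ncard_ne_zero h.ne'

theorem exists_adj_forall_ne_nonneg {w : V → ℤ} {u : V} {l : ℕ} (hG : 0 < G.edgeSet.ncard)
    (hw : ∀ v ≠ u, (∃ x, G.Adj v x) → 0 ≤ w v) (hwu : -(l : ℤ) ≤ w u) :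
    ∃ b a, G.Adj b a ∧ -(l : ℤ) ≤ w b ∧ ∀ v ≠ b, (∃ x, G.Adj v x) → 0 ≤ w v := by
  by_cases hu : ∃ a, G.Adj u a
  · obtain ⟨a, hua⟩ := hu
    exact ⟨u, a, hua, hwu, hw⟩
  · obtain ⟨b, a, hba⟩ := exists_adj_of_ncard_edgeSet_pos hG
    have hne {v : V} (hv : ∃ x, G.Adj v x) : v ≠ u := fun h => hu (h ▸ hv)
    have hwb := hw b (hne ⟨a, hba⟩) ⟨a, hba⟩
    exact ⟨b, a, hba, by omega, fun v _ hv => hw v (hne hv) hv⟩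

theorem arcGraph_singleton_le {a b : V} (hab : G.Adj a b) : arcGraph {(a, b)} ≤ G :=
  arcGraph_le fun _ hp => Finset.mem_singleton.1 hp ▸ hab

theorem ncard_edgeSet_sdiff_arcGraph_singleton [Finite V] {a b : V} (hab : G.Adj a b) :
    (G \ arcGraph {(a, b)}).edgeSet.ncard + 1 = G.edgeSet.ncard :=
  ncard_edgeSet_sdiff_arcGraph (by simp [hab.ne]) (arcGraph_singleton_le hab)

theorem IsLabeling.add_arcLabeling_singleton {L : Finset ℕ} {f : V → V → ℕ} {a b : V} {l : ℕ}
    (hf : IsLabeling (G \ arcGraph {(a, b)}) (L.erase l) f) (hab : G.Adj a b) (hl : l ∈ L)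
    (hl0 : l ≠ 0) : IsLabeling G L (f + arcLabeling {(a, b)} fun _ => l) := by
  simpa [Finset.insert_erase hl] using hf.add_arcLabeling (ℓ := fun _ => l) (by simp [hab.ne])
    (arcGraph_singleton_le hab) (by simp) (by simp [hl0]) (by simp)

variable [Fintype V]

/-- Arcs are directed towards a current vertex `u`, the only one whose sum may be negative, and
labels increase: the arc entering `u` repairs it, and its tail becomes the current vertex. -/
theorem exists_isLabeling_add_netSum_ge {B : ℕ} {L : Finset ℕ} (hL0 : 0 ∉ L)
    (hLB : ∀ l ∈ L, l ≤ B) (hGL : G.edgeSet.ncard = L.card) {w : V → ℤ} {u : V}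
    (hwB : ∀ v, -(B : ℤ) ≤ w v) (hw : ∀ v ≠ u, (∃ x, G.Adj v x) → 0 ≤ w v)
    (hwu : ∀ l ∈ L, -(l : ℤ) ≤ w u) :
    ∃ f, IsLabeling G L f ∧ ∀ v, -(B : ℤ) ≤ w v + netSum f v := by
  classical
  induction hn : L.card generalizing L G w u with
  | zero =>
    obtain rfl := Finset.card_eq_zero.1 hn
    obtain rfl : G = ⊥ := by rwa [hn, Set.ncard_eq_zero, edgeSet_eq_empty] at hGL
    exact ⟨0, ⟨by simp, by simp, by simp [Function.uncurry_def]⟩, by simpa [netSum] using hwB⟩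
  | succ n ih =>
    have hLne : L.Nonempty := Finset.card_pos.1 (by omega)
    set l := L.min' hLne
    have hl : l ∈ L := L.min'_mem hLne
    obtain ⟨b, a, hba, hwb, hw⟩ := exists_adj_forall_ne_nonneg (by omega) hw (hwu l hl)
    have hwa : 0 ≤ w a := hw a hba.ne' ⟨b, hba.symm⟩
    set w' := w + netSum (arcLabeling {(a, b)} fun _ => l) with hw'
    have hwa' : w' a = w a - l := by
      simp [hw', netSum_arcLabeling_singleton, hba.ne', sub_eq_add_neg]
    have hwb' : w' b = w b + l := by simp [hw', netSum_arcLabeling_singleton, hba.ne]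
    have hwv' {v : V} (hv : v ≠ a) : w v ≤ w' v :=
      le_add_of_nonneg_right (netSum_arcLabeling_nonneg (by simpa using hv.symm))
    have hwB' (v : V) : -(B : ℤ) ≤ w' v := by
      obtain rfl | hva := eq_or_ne v a
      · have := hLB l hl
        omega
      · exact (hwB v).trans (hwv' hva)
    have hnonneg : ∀ v ≠ a, (∃ x, (G \ arcGraph {(a, b)}).Adj v x) → 0 ≤ w' v :=
      fun v hva ⟨x, hvx⟩ => by
        obtain rfl | hvb := eq_or_ne v b
        · omega
        · exact (hw v hvb ⟨x, hvx.1⟩).trans (hwv' hva)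
    have hcard := ncard_edgeSet_sdiff_arcGraph_singleton hba.symm
    have hcard' := Finset.card_erase_of_mem hl
    obtain ⟨f, hf, hfB⟩ := ih (L := L.erase l) (u := a) (by simp [hL0])
      (fun l' h => hLB l' (Finset.mem_of_mem_erase h)) (by omega) hwB' hnonneg
      (fun l' hl' => by
        have := L.min'_le l' (Finset.mem_of_mem_erase hl')
        omega) (by omega)
    refine ⟨f + arcLabeling {(a, b)} (fun _ => l),
      hf.add_arcLabeling_singleton hba.symm hl (ne_of_mem_of_not_mem hl hL0), fun v => ?_⟩
    rw [netSum_add, add_comm (netSum f v), ← add_assoc]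
    exact hfB v

theorem exists_isLabeling_netSum_ge {B : ℕ} {L : Finset ℕ} (hL0 : 0 ∉ L) (hLB : ∀ l ∈ L, l ≤ B)
    (hGL : G.edgeSet.ncard = L.card) : ∃ f, IsLabeling G L f ∧ ∀ v, -(B : ℤ) ≤ netSum f v := by
  cases isEmpty_or_nonempty V
  · obtain rfl : L = ∅ := by
      rw [← Finset.card_eq_zero, ← hGL, Set.eq_empty_of_isEmpty G.edgeSet, Set.ncard_empty]
    exact ⟨0, ⟨isEmptyElim, isEmptyElim, by simp [Function.uncurry_def]⟩, isEmptyElim⟩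
  · have u : V := Classical.arbitrary V
    simpa using exists_isLabeling_add_netSum_ge hL0 hLB hGL (w := 0) (u := u) (by simp) (by simp)
      (by simp)

end Greedy

section Finset

variable {α : Type*}

theorem exists_injOn_extend {P K : Finset α} {L : Finset ℕ} {ℓ : α → ℕ} (hPK : P ⊆ K)
    (hcard : K.card ≤ L.card) (hℓ : Set.InjOn ℓ P) (hℓL : Set.MapsTo ℓ P L) :
    ∃ ℓ' : α → ℕ, Set.InjOn ℓ' K ∧ Set.MapsTo ℓ' K L ∧ Set.EqOn ℓ' ℓ P := by
  classical
  obtain ⟨L', hPL', hL'L, hL'⟩ := Finset.exists_subsuperset_card_eq (s := P.image ℓ) (t := L)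
    (Finset.image_subset_iff.2 hℓL)
    (Finset.card_image_le.trans (Finset.card_le_card hPK)) hcard
  obtain ⟨e, he⟩ := Set.MapsTo.exists_equiv_extend_of_card_eq (α := K) (t := L')
    ((Fintype.card_coe K).trans hL'.symm) (s := {p : K | (p : α) ∈ P}) (f := fun p => ℓ p)
    (fun p hp => hPL' (Finset.mem_image_of_mem ℓ hp))
    (fun p hp q hq h => Subtype.ext (hℓ hp hq h))
  refine ⟨fun p => if h : p ∈ K then e ⟨p, h⟩ else 0, fun p hp q hq h => ?_, fun p hp => ?_,
    fun p hp => ?_⟩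
  · simpa [Finset.mem_coe.1 hp, Finset.mem_coe.1 hq] using h
  · simpa [Finset.mem_coe.1 hp] using hL'L (e ⟨p, hp⟩).2
  · simpa [hPK hp] using he ⟨p, hPK hp⟩ hp

/-- Increasing labels are assigned in increasing order of `w`. -/
theorem exists_bijOn_Icc_injOn_add (T : Finset α) (w : α → ℤ) (M : ℕ) :
    ∃ r : α → ℕ, Set.BijOn r T (Set.Icc (M + 1) (M + T.card)) ∧
      Set.InjOn (fun t => w t + r t) T := by
  classical
  induction T using Finset.induction_on_max_value w with
  | empty => exact ⟨0, by simp, by simp⟩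
  | insert a s ha hmax ih =>
    obtain ⟨r, hr, hinj⟩ := ih
    set r' := Function.update r a (M + s.card + 1)
    have hr'a : r' a = M + s.card + 1 := Function.update_self ..
    have heq : Set.EqOn r r' s := fun t ht =>
      (Function.update_of_ne (ne_of_mem_of_not_mem (Finset.mem_coe.1 ht) ha) _ _).symm
    refine ⟨r', ?_, ?_⟩
    · have hIcc : Set.Icc (M + 1) (M + (insert a s).card) =
          insert (r' a) (Set.Icc (M + 1) (M + s.card)) := by
        rw [hr'a, Finset.card_insert_of_notMem ha]
        ext l
        simp only [Set.mem_Icc, Set.mem_insert_iff]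
        omega
      rw [hIcc, Finset.coe_insert]
      exact (hr.congr heq).insert (by simp [hr'a])
    · rw [Finset.coe_insert, Set.injOn_insert (Finset.mem_coe.not.2 ha)]
      refine ⟨hinj.congr fun t ht => by simp only [heq ht], ?_⟩
      rintro ⟨t, ht, h⟩
      have := (hr.mapsTo ht).2
      have := hmax t ht
      simp only [← heq ht, hr'a] at h
      omega

end Finset

section Dominating

variable {V : Type*} {G : SimpleGraph V} {E : Finset (V × V)} {ℓ : V × V → ℕ}

theorem exists_isLabeling_extend [Fintype V] {P : Finset (V × V)} (hE : ∀ p ∈ E, p.swap ∉ E)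
    (hle : arcGraph E ≤ G) (hPE : P ⊆ E) (hℓ : Set.InjOn ℓ P)
    (hℓP : ∀ p ∈ P, ℓ p ∈ Finset.Icc 1 G.edgeSet.ncard) :
    ∃ f, IsLabeling G (Finset.Icc 1 G.edgeSet.ncard) f ∧ (∀ p ∈ P, f p.1 p.2 = ℓ p) ∧
      (∀ p ∈ E, f p.1 p.2 ≠ 0) ∧
      ∀ v, (∀ p ∈ E, p.1 ≠ v) → -(G.edgeSet.ncard : ℤ) ≤ netSum f v := by
  classical
  set M := G.edgeSet.ncard
  have hcard : (G \ arcGraph E).edgeSet.ncard + E.card = M := ncard_edgeSet_sdiff_arcGraph hE hle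
  obtain ⟨ℓ', hinj, hmaps, heq⟩ := exists_injOn_extend (L := Finset.Icc 1 M) hPE
    (by rw [Nat.card_Icc]; omega) hℓ hℓP
  have himage : E.image ℓ' ⊆ Finset.Icc 1 M := Finset.image_subset_iff.2 hmaps
  have hpos : ∀ p ∈ E, ℓ' p ≠ 0 := fun p hp =>
    Nat.one_le_iff_ne_zero.1 (Finset.mem_Icc.1 (hmaps hp)).1
  obtain ⟨f, hf, hfM⟩ := exists_isLabeling_netSum_ge (B := M) (G := G \ arcGraph E)
    (L := Finset.Icc 1 M \ E.image ℓ') (by simp)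
    (fun l hl => (Finset.mem_Icc.1 (Finset.mem_sdiff.1 hl).1).2) (by
      rw [Finset.card_sdiff_of_subset himage, Finset.card_image_of_injOn hinj, Nat.card_Icc]
      omega)
  have hval : ∀ p ∈ E, (f + arcLabeling E ℓ') p.1 p.2 = ℓ' p := fun p hp => by
    have hfp : f p.1 p.2 = 0 :=
      hf.eq_zero_of_not_adj fun h => h.2 ((arcGraph_adj hE).2 (Or.inl hp))
    rw [Pi.add_apply, Pi.add_apply, hfp, zero_add, arcLabeling_of_mem hp]
  refine ⟨f + arcLabeling E ℓ', ?_, fun p hp => ?_, fun p hp => ?_, fun v hv => ?_⟩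
  · simpa [Finset.sdiff_union_of_subset himage] using hf.add_arcLabeling hE hle hinj hpos
      (fun p hp h => (Finset.mem_sdiff.1 h).2 (Finset.mem_image_of_mem ℓ' hp))
  · rw [hval p (hPE hp), heq hp]
  · rw [hval p hp]
    exact hpos p hp
  · rw [netSum_add]
    linarith [hfM v, netSum_arcLabeling_nonneg (ℓ := ℓ') hv]

/-- `φ` selects a neighbour in `S` of every vertex outside `S`; the arc from `φ t` to `t` is the
one reserved for a large label. -/
def IsSelector (G : SimpleGraph V) (S : Finset V) (φ : V → V) : Prop :=
  ∀ t ∉ S, φ t ∈ S ∧ G.Adj (φ t) t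

/-- An antimagic orientation as required by `G.HasAntimagicOrientation`, except that vertices of `S`
may have equal sums; `S` consists of sources, so their sums differ from the others by sign. -/
structure IsAntimagicOutside [Fintype V] (G : SimpleGraph V) (S : Finset V) (g : V → V → ℕ) :
    Prop where
  isLabeling : IsLabeling G (Finset.Icc 1 G.edgeSet.ncard) g
  source (s : V) (hs : s ∈ S) (v : V) : g v s = 0
  pos (t : V) (ht : t ∉ S) : 0 < netSum g t
  injOn : Set.InjOn (netSum g) {t | t ∉ S}

theorem IsAntimagicOutside.ne_zero [Fintype V] {S : Finset V} {g : V → V → ℕ}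
    (h : IsAntimagicOutside G S g) {x c : V} (hx : x ∈ S) (hxc : G.Adj x c) : g x c ≠ 0 :=
  ((h.isLabeling.adj_iff x c).1 hxc).resolve_right fun h0 => h0 (h.source x hx c)

theorem IsAntimagicOutside.arc_eq_of_label_eq [Fintype V] {S : Finset V} {g : V → V → ℕ}
    (h : IsAntimagicOutside G S g) {x y c d : V} (hx : x ∈ S) (hxc : G.Adj x c)
    (hxy : g x c = g y d) : (x, c) = (y, d) := by
  have hxc0 : g x c ≠ 0 := h.ne_zero hx hxc
  have hyd0 : g y d ≠ 0 := hxy ▸ hxc0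
  exact h.isLabeling.bijOn.injOn hxc0 hyd0 hxy

theorem IsAntimagicOutside.le_ncard_edgeSet [Fintype V] {S : Finset V} {g : V → V → ℕ}
    (h : IsAntimagicOutside G S g) (u v : V) : g u v ≤ G.edgeSet.ncard := by
  by_cases h0 : g u v = 0
  · exact h0.trans_le (Nat.zero_le _)
  · exact (Finset.mem_Icc.1 (h.isLabeling.mem_of_ne_zero h0)).2

theorem IsAntimagicOutside.hasAntimagicOrientation [Fintype V] {S : Finset V} {g : V → V → ℕ}
    (h : IsAntimagicOutside G S g) (hS : Set.InjOn (netSum g) S) : G.HasAntimagicOrientation := by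
  have hnonpos : ∀ s ∈ S, netSum g s ≤ 0 := fun s hs =>
    Finset.sum_nonpos fun v _ => by simp [h.source s hs v]
  refine h.isLabeling.hasAntimagicOrientation fun u v huv => ?_
  by_cases hu : u ∈ S <;> by_cases hv : v ∈ S
  · exact hS hu hv huv
  · have := hnonpos u hu
    have := h.pos v hv
    omega
  · have := h.pos u hu
    have := hnonpos v hv
    omega
  · exact h.injOn hu hv huv

variable [Fintype V] [DecidableEq V] {S : Finset V} {φ : V → V}

/-- The arcs `(φ t, t)` for `t ∉ S`, which receive the largest labels. -/
def reservedArcs (S : Finset V) (φ : V → V) : Finset (V × V) :=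
  Sᶜ.image fun t => (φ t, t)

theorem mem_reservedArcs {p : V × V} : p ∈ reservedArcs S φ ↔ p.2 ∉ S ∧ φ p.2 = p.1 := by
  simp only [reservedArcs, Finset.mem_image, Finset.mem_compl, Prod.ext_iff]
  grind

theorem card_reservedArcs (S : Finset V) (φ : V → V) : (reservedArcs S φ).card = Sᶜ.card :=
  Finset.card_image_of_injective _ fun _ _ h => congrArg Prod.snd h

namespace IsSelector

theorem swap_notMem (hφ : IsSelector G S φ) : ∀ p ∈ reservedArcs S φ, p.swap ∉ reservedArcs S φ :=
  fun p hp hp' => by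
    obtain ⟨ht, h⟩ := mem_reservedArcs.1 hp
    exact (mem_reservedArcs.1 hp').1 (h ▸ (hφ p.2 ht).1 : p.1 ∈ S)

theorem arcGraph_le (hφ : IsSelector G S φ) : arcGraph (reservedArcs S φ) ≤ G :=
  AntimagicOrientation.arcGraph_le fun p hp => by
    obtain ⟨ht, h⟩ := mem_reservedArcs.1 hp
    exact h ▸ (hφ p.2 ht).2

theorem ncard_edgeSet (hφ : IsSelector G S φ) :
    (G \ arcGraph (reservedArcs S φ)).edgeSet.ncard + Sᶜ.card = G.edgeSet.ncard := by
  rw [← card_reservedArcs S φ, ncard_edgeSet_sdiff_arcGraph hφ.swap_notMem hφ.arcGraph_le]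

theorem netSum_arcLabeling (hφ : IsSelector G S φ) {t : V} (ht : t ∉ S) :
    netSum (arcLabeling (reservedArcs S φ) ℓ) t = ℓ (φ t, t) := by
  have hout (v : V) : arcLabeling (reservedArcs S φ) ℓ t v = 0 :=
    arcLabeling_of_notMem fun h => by
      obtain ⟨hv, h : φ v = t⟩ := mem_reservedArcs.1 h
      exact ht (h ▸ (hφ v hv).1)
  rw [netSum, Finset.sum_eq_single (φ t) (fun v _ hv => ?_) (by simp), hout,
    arcLabeling_of_mem (mem_reservedArcs.2 ⟨ht, rfl⟩), Nat.cast_zero, sub_zero]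
  rw [hout, arcLabeling_of_notMem fun h => hv (mem_reservedArcs.1 h).2.symm, sub_self]

theorem isLabeling_add (hφ : IsSelector G S φ) {M : ℕ} {f : V → V → ℕ} {r : V → ℕ}
    (hf : IsLabeling (G \ arcGraph (reservedArcs S φ)) (Finset.Icc 1 M) f)
    (hM : M + Sᶜ.card = G.edgeSet.ncard)
    (hr : Set.BijOn r (Sᶜ : Finset V) (Set.Icc (M + 1) (M + Sᶜ.card))) :
    IsLabeling G (Finset.Icc 1 G.edgeSet.ncard)
      (f + arcLabeling (reservedArcs S φ) fun p => r p.2) := by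
  have hmem {p : V × V} (hp : p ∈ reservedArcs S φ) : p.2 ∈ Sᶜ :=
    Finset.mem_compl.2 (mem_reservedArcs.1 hp).1
  have hlt {p : V × V} (hp : p ∈ reservedArcs S φ) : M < r p.2 := (hr.mapsTo (hmem hp)).1
  have hinj : Set.InjOn (fun p : V × V => r p.2) (reservedArcs S φ) := fun p hp q hq h => by
    have h2 : p.2 = q.2 := hr.injOn (hmem hp) (hmem hq) h
    exact Prod.ext (by rw [← (mem_reservedArcs.1 hp).2, h2, (mem_reservedArcs.1 hq).2]) h2
  have himage : (reservedArcs S φ).image (fun p => r p.2) =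
      Finset.Icc (M + 1) (M + Sᶜ.card) := by
    rw [reservedArcs, Finset.image_image, ← Finset.coe_inj, Finset.coe_Icc, Finset.coe_image]
    exact hr.image_eq
  have hIcc : Finset.Icc 1 M ∪ Finset.Icc (M + 1) (M + Sᶜ.card) =
      Finset.Icc 1 G.edgeSet.ncard := by
    ext l
    simp only [Finset.mem_union, Finset.mem_Icc]
    omega
  rw [← hIcc, ← himage]
  exact hf.add_arcLabeling hφ.swap_notMem hφ.arcGraph_le hinj
    (fun p hp => Nat.ne_zero_of_lt (hlt hp))
    fun p hp hl => (hlt hp).not_ge (Finset.mem_Icc.1 hl).2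

theorem exists_isAntimagicOutside_of_isLabeling (hφ : IsSelector G S φ) {M : ℕ} {f : V → V → ℕ}
    (hf : IsLabeling (G \ arcGraph (reservedArcs S φ)) (Finset.Icc 1 M) f)
    (hM : M + Sᶜ.card = G.edgeSet.ncard) (hsource : ∀ s ∈ S, ∀ v, f v s = 0)
    (hfM : ∀ t ∉ S, -(M : ℤ) ≤ netSum f t) :
    ∃ g, IsAntimagicOutside G S g ∧ (∀ s v, φ v ≠ s → g s v = f s v) ∧
      ∀ t ∉ S, M < g (φ t) t := by
  obtain ⟨r, hr, hinj⟩ := exists_bijOn_Icc_injOn_add Sᶜ (netSum f) M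
  have hlt {t : V} (ht : t ∉ S) : M < r t := (hr.mapsTo (Finset.mem_coe.2 (by simpa))).1
  set g := f + arcLabeling (reservedArcs S φ) fun p => r p.2 with hg
  have hnet : ∀ t ∉ S, netSum g t = netSum f t + r t := fun t ht => by
    rw [hg, netSum_add, hφ.netSum_arcLabeling ht]
  have hval {u v : V} (huv : (u, v) ∉ reservedArcs S φ) : g u v = f u v := by
    rw [hg, Pi.add_apply, Pi.add_apply, arcLabeling_of_notMem huv, add_zero]
  refine ⟨g, ⟨hφ.isLabeling_add hf hM hr, fun s hs v => ?_, fun t ht => ?_, ?_⟩,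
    fun s v hv => hval fun h => hv (mem_reservedArcs.1 h).2, fun t ht => ?_⟩
  · rw [hval fun h => (mem_reservedArcs.1 h).1 hs, hsource s hs]
  · have := hfM t ht
    have := hnet t ht
    have := hlt ht
    omega
  · exact (hinj.mono fun t ht => Finset.mem_compl.2 ht).congr fun t ht => (hnet t ht).symm
  · rw [hg, Pi.add_apply, Pi.add_apply, arcLabeling_of_mem (mem_reservedArcs.2 ⟨ht, rfl⟩)]
    exact (hlt ht).trans_le (Nat.le_add_left _ _)

theorem arcGraph_le_sdiff (hφ : IsSelector G S φ)
    (hE : ∀ p ∈ E, p.1 ∈ S ∧ G.Adj p.1 p.2 ∧ φ p.2 ≠ p.1) :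
    arcGraph E ≤ G \ arcGraph (reservedArcs S φ) :=
  AntimagicOrientation.arcGraph_le fun p hp => by
    obtain ⟨hs, hadj, hne⟩ := hE p hp
    refine ⟨hadj, fun h => ?_⟩
    rcases (arcGraph_adj hφ.swap_notMem).1 h with h | h
    · exact hne (mem_reservedArcs.1 h).2
    · exact (mem_reservedArcs.1 h).1 hs

theorem label_eq_zero_of_mem (hφ : IsSelector G S φ) (hS : G.IsIndepSet S) {L : Finset ℕ}
    {f : V → V → ℕ} (hf : IsLabeling (G \ arcGraph (reservedArcs S φ)) L f)
    (hout : ∀ s ∈ S, ∀ v, G.Adj s v → φ v ≠ s → f s v ≠ 0) {s : V} (hs : s ∈ S) (v : V) :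
    f v s = 0 := by
  by_cases hadj : G.Adj s v
  · by_cases hsv : φ v = s
    · refine hf.eq_zero_of_not_adj fun h => h.2 ((arcGraph_adj hφ.swap_notMem).2 (Or.inr ?_))
      exact mem_reservedArcs.2 ⟨fun hv => hS hs hv hadj.ne hadj, hsv⟩
    · exact hf.asymm s v (hout s hs v hadj hsv)
  · exact hf.eq_zero_of_not_adj fun h => hadj h.1.symm

theorem exists_isAntimagicOutside (hφ : IsSelector G S φ) (hS : G.IsIndepSet S)
    {P : Finset (V × V)} (hP : ∀ p ∈ P, p.1 ∈ S ∧ G.Adj p.1 p.2 ∧ φ p.2 ≠ p.1)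
    (hℓ : Set.InjOn ℓ P) (hℓP : ∀ p ∈ P, 1 ≤ ℓ p ∧ ℓ p + Sᶜ.card ≤ G.edgeSet.ncard) :
    ∃ g, IsAntimagicOutside G S g ∧ (∀ p ∈ P, g p.1 p.2 = ℓ p) ∧
      ∀ t ∉ S, G.edgeSet.ncard < g (φ t) t + Sᶜ.card := by
  classical
  set R := reservedArcs S φ
  have hM : (G \ arcGraph R).edgeSet.ncard + Sᶜ.card = G.edgeSet.ncard := hφ.ncard_edgeSet
  set E : Finset (V × V) := {p | p.1 ∈ S ∧ G.Adj p.1 p.2 ∧ φ p.2 ≠ p.1}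
  have hmemE {p : V × V} : p ∈ E ↔ p.1 ∈ S ∧ G.Adj p.1 p.2 ∧ φ p.2 ≠ p.1 := by simp [E]
  have hswap : ∀ p ∈ E, p.swap ∉ E := fun p hp hp' => by
    obtain ⟨hs, hadj, -⟩ := hmemE.1 hp
    exact hS hs (hmemE.1 hp').1 hadj.ne hadj
  have hle : arcGraph E ≤ G \ arcGraph R := hφ.arcGraph_le_sdiff fun p => hmemE.1
  obtain ⟨f, hf, hfP, hfE, hfM⟩ := exists_isLabeling_extend hswap hle
    (fun p hp => hmemE.2 (hP p hp)) hℓ fun p hp => Finset.mem_Icc.2 (by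
      have := hℓP p hp
      omega)
  have hsource : ∀ s ∈ S, ∀ v, f v s = 0 := fun s hs => hφ.label_eq_zero_of_mem hS hf
    (fun s hs v hadj hsv => hfE (s, v) (hmemE.2 ⟨hs, hadj, hsv⟩)) hs
  obtain ⟨g, hg, hgf, hgM⟩ := hφ.exists_isAntimagicOutside_of_isLabeling hf hM hsource
    fun t ht => hfM t fun p hp => ne_of_mem_of_not_mem (hmemE.1 hp).1 ht
  refine ⟨g, hg, fun p hp => ?_, fun t ht => ?_⟩
  · rw [hgf _ _ (hP p hp).2.2, hfP p hp]
  · have := hgM t ht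
    omega

end IsSelector

end Dominating

section Permute

variable {V : Type*} [DecidableEq V] {G : SimpleGraph V} {g : V → V → ℕ} {c : V}
  {σ : Equiv.Perm V}

/-- The labels of the arcs into `c` are permuted along the tails of these arcs: the arc from `u`
receives the label of the arc from `σ u`. -/
def permuteInto (g : V → V → ℕ) (c : V) (σ : Equiv.Perm V) (u v : V) : ℕ :=
  if v = c then g (σ u) c else g u v

@[simp]
theorem permuteInto_self (u : V) : permuteInto g c σ u c = g (σ u) c :=
  if_pos rfl

theorem permuteInto_of_ne {v : V} (hv : v ≠ c) (u : V) : permuteInto g c σ u v = g u v :=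
  if_neg hv

theorem IsLabeling.permuteInto {L : Finset ℕ} (h : IsLabeling G L g)
    (hσ : ∀ u, g (σ u) c = 0 ↔ g u c = 0) : IsLabeling G L (permuteInto g c σ) := by
  have hzero (u v : V) : AntimagicOrientation.permuteInto g c σ u v = 0 ↔ g u v = 0 := by
    rcases eq_or_ne v c with rfl | hv
    · rw [permuteInto_self, hσ]
    · rw [permuteInto_of_ne hv]
  let e : Equiv.Perm (V × V) := Equiv.prodCongrLeft (Pi.mulSingle c σ)
  have he : Function.uncurry (AntimagicOrientation.permuteInto g c σ) = Function.uncurry g ∘ e := by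
    ext ⟨u, v⟩
    rcases eq_or_ne v c with rfl | hv
    · simp [e]
    · simp [e, permuteInto_of_ne hv, hv]
  refine ⟨fun u v => by simp only [h.adj_iff, ne_eq, hzero], fun u v huv => ?_, ?_⟩
  · exact (hzero v u).2 (h.asymm u v fun h0 => huv ((hzero u v).2 h0))
  · rw [he]
    exact h.bijOn.comp (e.bijOn fun p => Iff.rfl)

/-- The labels of the arcs into `c` from `x` and from `y` are exchanged. -/
abbrev swapInto (g : V → V → ℕ) (c x y : V) : V → V → ℕ :=
  permuteInto g c (Equiv.swap x y)

/-- The amount by which the sum of `x` grows, and that of `y` drops, under `swapInto g c x y`. -/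
def gap (g : V → V → ℕ) (c x y : V) : ℤ :=
  g x c - g y c

theorem gap_swapInto (x y : V) : gap (swapInto g c x y) c x y = -gap g c x y := by
  simp [gap]

theorem gap_permuteInto_of_ne {d : V} (hd : d ≠ c) (x y : V) :
    gap (permuteInto g c σ) d x y = gap g d x y := by
  simp only [gap, permuteInto_of_ne hd]

theorem netSum_permuteInto [Fintype V] (u : V) :
    netSum (permuteInto g c σ) u = netSum g u + (g u c - g (σ u) c) := by
  have hin : ∑ v, (permuteInto g c σ v u : ℤ) = ∑ v, (g v u : ℤ) := by
    rcases eq_or_ne u c with rfl | hu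
    · simp only [permuteInto_self]
      exact Equiv.sum_comp σ fun v => (g v u : ℤ)
    · simp only [permuteInto_of_ne hu]
  have hout : ∑ v, ((g u v : ℤ) - permuteInto g c σ u v) = g u c - g (σ u) c := by
    rw [Finset.sum_eq_single c (fun v _ hv => ?_) (by simp), permuteInto_self]
    rw [permuteInto_of_ne hv, sub_self]
  rw [Finset.sum_sub_distrib] at hout
  simp only [netSum, Finset.sum_sub_distrib]
  linarith

variable [Fintype V] {S : Finset V}

theorem IsAntimagicOutside.permuteInto (h : IsAntimagicOutside G S g)
    (hσ : ∀ u, σ u ≠ u → u ∈ S ∧ G.Adj u c) : IsAntimagicOutside G S (permuteInto g c σ) := by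
  have hne {u : V} (hu : σ u ≠ u) : g u c ≠ 0 := h.ne_zero (hσ u hu).1 (hσ u hu).2
  have hzero (u : V) : g (σ u) c = 0 ↔ g u c = 0 := by
    by_cases hu : σ u = u
    · rw [hu]
    · simp only [hne hu, hne fun h0 => hu (σ.injective h0)]
  have hnet {t : V} (ht : t ∉ S) :
      netSum (AntimagicOrientation.permuteInto g c σ) t = netSum g t := by
    rw [netSum_permuteInto, not_imp_comm.1 (hσ t) fun h0 => ht h0.1, sub_self, add_zero]
  refine ⟨h.isLabeling.permuteInto hzero, fun s hs v => ?_, fun t ht => ?_, ?_⟩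
  · rcases eq_or_ne s c with rfl | hsc
    · rw [permuteInto_self, h.source s hs]
    · rw [permuteInto_of_ne hsc, h.source s hs]
  · rw [hnet ht]
    exact h.pos t ht
  · exact h.injOn.congr fun t ht => (hnet ht).symm

theorem netSum_swapInto_left (x y : V) :
    netSum (swapInto g c x y) x = netSum g x + gap g c x y := by
  rw [netSum_permuteInto, Equiv.swap_apply_left, gap]

theorem netSum_swapInto_right (x y : V) :
    netSum (swapInto g c x y) y = netSum g y - gap g c x y := by
  rw [netSum_permuteInto, Equiv.swap_apply_right, gap]
  ring

theorem netSum_swapInto_of_ne {x y u : V} (hx : u ≠ x) (hy : u ≠ y) :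
    netSum (swapInto g c x y) u = netSum g u := by
  rw [netSum_permuteInto, Equiv.swap_apply_of_ne_of_ne hx hy, sub_self, add_zero]

theorem IsAntimagicOutside.swapInto {x y : V} (h : IsAntimagicOutside G S g) (hx : x ∈ S)
    (hy : y ∈ S) (hxc : G.Adj x c) (hyc : G.Adj y c) :
    IsAntimagicOutside G S (swapInto g c x y) :=
  h.permuteInto fun u hu => by
    obtain ⟨-, rfl | rfl⟩ := Equiv.swap_apply_ne_self_iff.1 hu
    · exact ⟨hx, hxc⟩
    · exact ⟨hy, hyc⟩

/-- Exchanging the labels of the arcs into `c` from `x` and from `y` does not bring the sums of `x`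
and `y` farther apart. -/
def IsSwapOptimal (g : V → V → ℕ) (c x y : V) : Prop :=
  (netSum g x - netSum g y + 2 * gap g c x y).natAbs ≤ (netSum g x - netSum g y).natAbs

theorem isSwapOptimal_of_sum_sq_le {x y : V} (hx : x ∈ S) (hy : y ∈ S)
    (h : ∑ s ∈ S, netSum (swapInto g c x y) s ^ 2 ≤ ∑ s ∈ S, netSum g s ^ 2) :
    IsSwapOptimal g c x y := by
  rcases eq_or_ne x y with rfl | hxy
  · simp [IsSwapOptimal, gap]
  have hsplit (f : V → ℤ) :
      ∑ s ∈ S, f s ^ 2 = f x ^ 2 + (f y ^ 2 + ∑ s ∈ (S.erase x).erase y, f s ^ 2) := by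
    rw [Finset.add_sum_erase _ (fun s => f s ^ 2) (Finset.mem_erase.2 ⟨hxy.symm, hy⟩),
      Finset.add_sum_erase _ (fun s => f s ^ 2) hx]
  have hrest : ∑ s ∈ (S.erase x).erase y, netSum (swapInto g c x y) s ^ 2 =
      ∑ s ∈ (S.erase x).erase y, netSum g s ^ 2 :=
    Finset.sum_congr rfl fun s hs => by
      simp only [Finset.mem_erase] at hs
      rw [netSum_swapInto_of_ne hs.2.1 hs.1]
  rw [hsplit, hsplit, hrest, netSum_swapInto_left, netSum_swapInto_right] at h
  rw [IsSwapOptimal, Int.natAbs_le_iff_sq_le]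
  linarith

theorem exists_isSwapOptimal {p : (V → V → ℕ) → Prop}
    (hp : ∃ g, IsAntimagicOutside G S g ∧ p g) :
    ∃ g, IsAntimagicOutside G S g ∧ p g ∧ ∀ c, ∀ x ∈ S, ∀ y ∈ S, G.Adj x c → G.Adj y c →
      p (swapInto g c x y) → IsSwapOptimal g c x y := by
  have hfin : {g | IsAntimagicOutside G S g ∧ p g}.Finite :=
    (Set.finite_Icc 0 fun _ _ => G.edgeSet.ncard).subset fun _ hg =>
      ⟨fun _ _ => Nat.zero_le _, hg.1.le_ncard_edgeSet⟩
  obtain ⟨g, ⟨hg, hpg⟩, hmax⟩ := Set.exists_max_image _ (fun g => ∑ s ∈ S, netSum g s ^ 2) hfin hp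
  exact ⟨g, hg, hpg, fun c x hx y hy hxc hyc h =>
    isSwapOptimal_of_sum_sq_le hx hy (hmax _ ⟨hg.swapInto hx hy hxc hyc, h⟩)⟩

end Permute

section Arithmetic

theorem nodup_quadruple {α : Type*} {x y z w : α} :
    [x, y, z, w].Nodup ↔ (x ≠ y ∧ x ≠ z ∧ x ≠ w) ∧ (y ≠ z ∧ y ≠ w) ∧ z ≠ w := by
  simp

theorem pos_or_neg_of_natAbs_add_le {a d : ℤ} (hd : 0 < d.natAbs)
    (h : (a + 2 * d).natAbs ≤ a.natAbs) : (0 < d ∧ a ≤ -d) ∨ (d < 0 ∧ -d ≤ a) := by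
  omega

theorem nodup_of_two_swaps {x y z d₁ d₂ : ℤ} (h₂ : 0 < d₂.natAbs)
    (h₁₂ : d₂.natAbs < d₁.natAbs) (k₁ : (x - y + 2 * d₁).natAbs ≤ (x - y).natAbs)
    (k₂ : (y - z + 2 * d₂).natAbs ≤ (y - z).natAbs) :
    [x, y, z].Nodup ∨ [x, y + d₂, z - d₂].Nodup ∨ [x + d₁, y - d₁ + d₂, z - d₂].Nodup := by
  simp only [List.nodup_cons, List.mem_cons, List.not_mem_nil, not_or, not_false_eq_true,
    List.nodup_nil, or_false, and_true]
  omega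

/-- The gaps at three common neighbours, of clearly separated sizes: `d₂` is small, `d₃` medium and
`d₁` large. -/
structure IsSpread (d₁ d₂ d₃ : ℤ) : Prop where
  pos : 0 < d₂.natAbs
  lt : d₂.natAbs < d₃.natAbs
  add_lt : 2 * d₃.natAbs + d₂.natAbs < d₁.natAbs

namespace IsSpread

variable {d₁ d₂ d₃ : ℤ}

theorem neg_left (h : IsSpread d₁ d₂ d₃) : IsSpread (-d₁) d₂ d₃ :=
  ⟨h.pos, h.lt, by simpa using h.add_lt⟩

theorem neg_middle (h : IsSpread d₁ d₂ d₃) : IsSpread d₁ (-d₂) d₃ :=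
  ⟨by simpa using h.pos, by simpa using h.lt, by simpa using h.add_lt⟩

theorem neg_right (h : IsSpread d₁ d₂ d₃) : IsSpread d₁ d₂ (-d₃) :=
  ⟨h.pos, by simpa using h.lt, by simpa using h.add_lt⟩

end IsSpread

theorem nodup_of_path_swaps {x y z w d₁ d₂ d₃ : ℤ} (hd : IsSpread d₁ d₂ d₃)
    (k₁ : (x - y + 2 * d₁).natAbs ≤ (x - y).natAbs)
    (k₂ : (y - z + 2 * d₂).natAbs ≤ (y - z).natAbs)
    (k₃ : (z - w + 2 * d₃).natAbs ≤ (z - w).natAbs) :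
    [x, y, z, w].Nodup ∨ [x, y + d₂, z - d₂, w].Nodup ∨ [x, y, z + d₃, w - d₃].Nodup ∨
      [x, y + d₂, z - d₂ + d₃, w - d₃].Nodup := by
  obtain ⟨h₂, h₃, h₁⟩ := hd
  by_contra! h
  simp only [nodup_quadruple] at h
  obtain ⟨n, n₂, n₃, n₂₃⟩ := h
  obtain ⟨s₁, j₁⟩ | ⟨s₁, j₁⟩ := pos_or_neg_of_natAbs_add_le (by omega) k₁ <;>
  obtain ⟨s₂, j₂⟩ | ⟨s₂, j₂⟩ := pos_or_neg_of_natAbs_add_le (by omega) k₂ <;>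
  obtain ⟨s₃, j₃⟩ | ⟨s₃, j₃⟩ := pos_or_neg_of_natAbs_add_le (by omega) k₃ <;>
  · zify at h₁ h₂ h₃
    simp only [abs_of_pos, abs_of_neg, s₁, s₂, s₃] at h₁ h₂ h₃
    -- `omega` splits every disequality in the context, so those not needed in a case are cleared.
    clear k₁ k₂ k₃
    by_cases hxz : x = z
    · clear n n₂₃
      omega
    by_cases hyw : y = w
    · clear n
      omega
    by_cases hxw : x = w
    · clear n n₂
      omega
    clear n₂ n₃ n₂₃
    omega

theorem nodup_of_star_swaps {x y z w d₁ d₂ d₃ : ℤ} (hd : IsSpread d₁ d₂ d₃)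
    (k₁ : (x - y + 2 * d₁).natAbs ≤ (x - y).natAbs)
    (k₂ : (x - z + 2 * d₂).natAbs ≤ (x - z).natAbs)
    (k₃ : (x - w + 2 * d₃).natAbs ≤ (x - w).natAbs) :
    [x, y, z, w].Nodup ∨ [x + d₂, y, z - d₂, w].Nodup ∨ [x + d₃, y, z, w - d₃].Nodup ∨
      [x + d₂ + d₃, y, z - d₂, w - d₃].Nodup ∨ [x + d₁ + d₃, y - d₁, z, w - d₃].Nodup ∨
      [x + d₁ + d₂, y - d₁, z - d₂, w].Nodup := by
  obtain ⟨h₂, h₃, h₁⟩ := hd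
  by_contra! h
  simp only [nodup_quadruple] at h
  obtain ⟨n, n₂, n₃, n₂₃, n₁₃, n₁₂⟩ := h
  obtain ⟨s₁, j₁⟩ | ⟨s₁, j₁⟩ := pos_or_neg_of_natAbs_add_le (by omega) k₁ <;>
  obtain ⟨s₂, j₂⟩ | ⟨s₂, j₂⟩ := pos_or_neg_of_natAbs_add_le (by omega) k₂ <;>
  obtain ⟨s₃, j₃⟩ | ⟨s₃, j₃⟩ := pos_or_neg_of_natAbs_add_le (by omega) k₃ <;>
  · zify at h₁ h₂ h₃
    simp only [abs_of_pos, abs_of_neg, s₁, s₂, s₃] at h₁ h₂ h₃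
    clear k₁ k₂ k₃
    by_cases hyz : y = z
    · by_cases hyw : y = w
      · clear n n₂ n₃ n₁₃ n₁₂
        omega
      · clear n n₃ n₁₂
        omega
    by_cases hyw : y = w
    · clear n n₂ n₁₃
      omega
    by_cases hzw : z = w
    · clear n n₁₃ n₁₂
      omega
    clear n₂ n₃ n₂₃ n₁₃ n₁₂
    omega

theorem nodup_of_triple_swaps {u v w a b d : ℤ} (ha : 0 < a.natAbs) (hb : 0 < b.natAbs)
    (hab : 0 < (b - a).natAbs) (had : 2 * a.natAbs < d.natAbs) (hbd : 2 * b.natAbs < d.natAbs)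
    (habd : 2 * (b - a).natAbs < d.natAbs) (k₁ : (u - v + 2 * a).natAbs ≤ (u - v).natAbs)
    (k₂ : (u - w + 2 * b).natAbs ≤ (u - w).natAbs)
    (k₃ : (v - w + 2 * (b - a)).natAbs ≤ (v - w).natAbs)
    (k₄ : (w - u + 2 * d).natAbs ≤ (w - u).natAbs) :
    [u + b, v, w - b, u].Nodup ∨ [u + a, v - a, w, u].Nodup ∨
      [u + b, v - a, w - b + a, u].Nodup := by
  by_contra! h
  simp only [nodup_quadruple] at h
  obtain ⟨n₁, n₂, n₃⟩ := h
  obtain ⟨s₁, j₁⟩ | ⟨s₁, j₁⟩ := pos_or_neg_of_natAbs_add_le ha k₁ <;>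
  obtain ⟨s₂, j₂⟩ | ⟨s₂, j₂⟩ := pos_or_neg_of_natAbs_add_le hb k₂ <;>
  obtain ⟨s₃, j₃⟩ | ⟨s₃, j₃⟩ := pos_or_neg_of_natAbs_add_le hab k₃ <;>
  obtain ⟨s₄, j₄⟩ | ⟨s₄, j₄⟩ := pos_or_neg_of_natAbs_add_le (by omega) k₄ <;>
  · zify at had hbd habd
    simp only [abs_of_pos, abs_of_neg, s₁, s₂, s₃, s₄] at had hbd habd
    clear k₁ k₂ k₃ k₄
    omega

end Arithmetic

section Cases

variable {V : Type*} {G : SimpleGraph V} {S : Finset V}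

/-- The vertices of `S` are pairwise non-adjacent, and all other vertices have a neighbour in
`S`. -/
structure IsIndepDominating (G : SimpleGraph V) (S : Finset V) : Prop where
  isIndepSet : G.IsIndepSet S
  exists_adj (t : V) (ht : t ∉ S) : ∃ s ∈ S, G.Adj s t

theorem IsIndepDominating.notMem_of_adj (hS : IsIndepDominating G S) {s t : V} (hs : s ∈ S)
    (hst : G.Adj s t) : t ∉ S :=
  fun ht => hS.isIndepSet hs ht hst.ne hst

theorem IsIndepDominating.exists_isSelector (hS : IsIndepDominating G S) {R : Finset (V × V)}
    (hR : ∀ p ∈ R, p.1 ∈ S ∧ G.Adj p.1 p.2) (hinj : Set.InjOn Prod.snd (R : Set (V × V))) :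
    ∃ φ, IsSelector G S φ ∧ ∀ p ∈ R, φ p.2 = p.1 := by
  have (t : V) : ∃ s, (t ∉ S → s ∈ S ∧ G.Adj s t) ∧ ∀ p ∈ R, p.2 = t → s = p.1 := by
    by_cases ht : ∃ p ∈ R, p.2 = t
    · obtain ⟨p, hp, rfl⟩ := ht
      exact ⟨p.1, fun _ => hR p hp, fun q hq h => congrArg Prod.fst (hinj hp hq h.symm)⟩
    · push Not at ht
      by_cases htS : t ∈ S
      · exact ⟨t, fun h => (h htS).elim, fun p hp h => (ht p hp h).elim⟩
      · obtain ⟨s, hs⟩ := hS.exists_adj t htS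
        exact ⟨s, fun _ => hs, fun p hp h => (ht p hp h).elim⟩
  choose φ hφ hφR using this
  exact ⟨φ, hφ, fun p hp => hφR _ p hp rfl⟩

variable [Fintype V]

theorem IsAntimagicOutside.hasAntimagicOrientation_of_nodup {g : V → V → ℕ}
    (h : IsAntimagicOutside G S g) {l : List V} (hl : ∀ s ∈ S, s ∈ l)
    (hnodup : (l.map (netSum g)).Nodup) : G.HasAntimagicOrientation :=
  h.hasAntimagicOrientation fun _ hs _ ht hst =>
    List.inj_on_of_nodup_map hnodup (hl _ hs) (hl _ ht) hst

theorem IsAntimagicOutside.gap_ne_zero {g : V → V → ℕ} (h : IsAntimagicOutside G S g) {x y c : V}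
    (hx : x ∈ S) (hxc : G.Adj x c) (hxy : x ≠ y) : gap g c x y ≠ 0 := fun h0 =>
  hxy (congrArg Prod.fst (h.arc_eq_of_label_eq hx hxc (Nat.cast_injective (sub_eq_zero.1 h0))))

theorem IsAntimagicOutside.netSum_ne {g : V → V → ℕ} (h : IsAntimagicOutside G S g) {x y c : V}
    (hx : x ∈ S) (hxc : G.Adj x c) (hxy : x ≠ y) (hopt : IsSwapOptimal g c x y) :
    netSum g x ≠ netSum g y := by
  have hgap := h.gap_ne_zero hx hxc hxy
  rw [IsSwapOptimal] at hopt
  omega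

variable [DecidableEq V]

theorem IsIndepDominating.exists_isAntimagicOutside (hS : IsIndepDominating G S)
    {R P : Finset (V × V)} {ℓ : V × V → ℕ} (hR : ∀ p ∈ R, p.1 ∈ S ∧ G.Adj p.1 p.2)
    (hinj : Set.InjOn Prod.snd (R : Set (V × V)))
    (hP : ∀ p ∈ P, p.1 ∈ S ∧ G.Adj p.1 p.2 ∧ ∃ q ∈ R, q.2 = p.2 ∧ q.1 ≠ p.1)
    (hℓ : Set.InjOn ℓ P) (hℓP : ∀ p ∈ P, 1 ≤ ℓ p ∧ ℓ p + Sᶜ.card ≤ G.edgeSet.ncard) :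
    ∃ g, IsAntimagicOutside G S g ∧ (∀ p ∈ P, g p.1 p.2 = ℓ p) ∧
      ∀ p ∈ R, G.edgeSet.ncard < g p.1 p.2 + Sᶜ.card := by
  obtain ⟨φ, hφ, hφR⟩ := hS.exists_isSelector hR hinj
  have hP' : ∀ p ∈ P, p.1 ∈ S ∧ G.Adj p.1 p.2 ∧ φ p.2 ≠ p.1 := fun p hp => by
    obtain ⟨hpS, hadj, q, hq, h2, h1⟩ := hP p hp
    exact ⟨hpS, hadj, by rwa [← h2, hφR q hq]⟩
  obtain ⟨g, hg, hgP, hgφ⟩ := hφ.exists_isAntimagicOutside hS.isIndepSet hP' hℓ hℓP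
  refine ⟨g, hg, hgP, fun p hp => ?_⟩
  exact hφR p hp ▸ hgφ p.2 (hS.notMem_of_adj (hR p hp).1 (hR p hp).2)

theorem IsIndepDominating.card_compl_pos (hS : IsIndepDominating G S) {s t : V} (hs : s ∈ S)
    (hst : G.Adj s t) : 0 < Sᶜ.card :=
  Finset.card_pos.2 ⟨t, Finset.mem_compl.2 (hS.notMem_of_adj hs hst)⟩

/-- Two vertices are linked if they have a common neighbour, at which their labels can be
exchanged. -/
def Linked (G : SimpleGraph V) (x y : V) : Prop :=
  ∃ c, G.Adj x c ∧ G.Adj y c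

omit [DecidableEq V] in
theorem IsIndepDominating.hasAntimagicOrientation_of_pairwise_linked
    (hS : IsIndepDominating G S) (hlink : (S : Set V).Pairwise (Linked G)) :
    G.HasAntimagicOrientation := by
  classical
  obtain ⟨g₀, hg₀, -⟩ := hS.exists_isAntimagicOutside (R := ∅) (P := ∅) (ℓ := 0) (by simp)
    (by simp) (by simp) (by simp) (by simp)
  obtain ⟨g, hg, -, hopt⟩ := exists_isSwapOptimal (p := fun _ => True) ⟨g₀, hg₀, trivial⟩
  refine hg.hasAntimagicOrientation fun x hx y hy hxy => by_contra fun hne => ?_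
  obtain ⟨c, hxc, hyc⟩ := hlink hx hy hne
  exact hg.netSum_ne hx hxc hne (hopt c x hx y hy hxc hyc trivial) hxy

theorem hasAntimagicOrientation_of_three {x y z c d : V} (hxyz : [x, y, z].Nodup)
    (hS : IsIndepDominating G {x, y, z}) (hcd : c ≠ d) (hxc : G.Adj x c) (hyc : G.Adj y c)
    (hyd : G.Adj y d) (hzd : G.Adj z d)
    (hm : 2 * ({x, y, z} : Finset V)ᶜ.card < G.edgeSet.ncard) : G.HasAntimagicOrientation := by
  have hk := hS.card_compl_pos (by simp) hxc
  obtain ⟨⟨hxy, hxz⟩, hyz⟩ : (x ≠ y ∧ x ≠ z) ∧ y ≠ z := by simpa using hxyz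
  set k := ({x, y, z} : Finset V)ᶜ.card
  set m := G.edgeSet.ncard
  obtain ⟨g₀, hg₀, hP, hR⟩ := hS.exists_isAntimagicOutside (R := {(y, c), (z, d)})
    (P := {(x, c), (y, d)}) (ℓ := fun p => if p.2 = c then 1 else m - k)
    (by simp [*]) (by simp [hcd]) (by simp [*, Ne.symm])
    (by grind [Set.InjOn]) (by grind)
  have hlt : (gap g₀ d y z).natAbs < (gap g₀ c x y).natAbs := by
    have hxc₁ : g₀ x c = 1 := by simpa using hP (x, c) (by simp)
    have hydM : g₀ y d = m - k := by simpa [hcd.symm] using hP (y, d) (by simp)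
    have hyck : m < g₀ y c + k := hR (y, c) (by simp)
    have hzdk : m < g₀ z d + k := hR (z, d) (by simp)
    have hzd_le := hg₀.le_ncard_edgeSet z d
    simp only [gap]
    omega
  obtain ⟨g, hg, hpg, hopt⟩ := exists_isSwapOptimal
    (p := fun g => (gap g d y z).natAbs < (gap g c x y).natAbs) ⟨g₀, hg₀, hlt⟩
  have k₁ := hopt c x (by simp) y (by simp) hxc hyc
    (by simpa [gap_swapInto, gap_permuteInto_of_ne hcd.symm] using hpg)
  have k₂ := hopt d y (by simp) z (by simp) hyd hzd
    (by simpa [gap_swapInto, gap_permuteInto_of_ne hcd] using hpg)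
  have hgap := hg.gap_ne_zero (by simp) hyd hyz
  rcases nodup_of_two_swaps (by omega) hpg k₁ k₂ with h | h | h
  · exact hg.hasAntimagicOrientation_of_nodup (l := [x, y, z]) (by simp) (by simpa using h)
  · refine (hg.swapInto (by simp) (by simp) hyd hzd).hasAntimagicOrientation_of_nodup
      (l := [x, y, z]) (by simp) ?_
    simpa [netSum_swapInto_left, netSum_swapInto_right, netSum_swapInto_of_ne, hxy, hxz] using h
  · refine ((hg.swapInto (by simp) (by simp) hxc hyc).swapInto (by simp) (by simp) hyd
      hzd).hasAntimagicOrientation_of_nodup (l := [x, y, z]) (by simp) ?_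
    simpa [netSum_swapInto_left, netSum_swapInto_right, netSum_swapInto_of_ne,
      gap_permuteInto_of_ne, hxy, hxz, hxz.symm, hyz.symm, hcd.symm] using h

theorem IsIndepDominating.exists_isSpread (hS : IsIndepDominating G S)
    {x₁ y₁ x₂ y₂ x₃ y₃ c₁ c₂ c₃ : V} (hc : [c₁, c₂, c₃].Nodup)
    (hS₁ : x₁ ∈ S ∧ y₁ ∈ S ∧ x₁ ≠ y₁) (hS₂ : x₂ ∈ S ∧ y₂ ∈ S ∧ x₂ ≠ y₂)
    (hS₃ : x₃ ∈ S ∧ y₃ ∈ S ∧ x₃ ≠ y₃) (h₁ : G.Adj x₁ c₁ ∧ G.Adj y₁ c₁)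
    (h₂ : G.Adj x₂ c₂ ∧ G.Adj y₂ c₂) (h₃ : G.Adj x₃ c₃ ∧ G.Adj y₃ c₃)
    (hm : 6 * Sᶜ.card ≤ G.edgeSet.ncard) :
    ∃ g, IsAntimagicOutside G S g ∧
      IsSpread (gap g c₁ x₁ y₁) (gap g c₂ x₂ y₂) (gap g c₃ x₃ y₃) := by
  obtain ⟨⟨h₁₂, h₁₃⟩, h₂₃⟩ : (c₁ ≠ c₂ ∧ c₁ ≠ c₃) ∧ c₂ ≠ c₃ := by simpa using hc
  have hk := hS.card_compl_pos hS₁.1 h₁.1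
  set k := Sᶜ.card
  set m := G.edgeSet.ncard
  obtain ⟨g, hg, hP, hR⟩ := hS.exists_isAntimagicOutside (R := {(y₁, c₁), (y₂, c₂), (y₃, c₃)})
    (P := {(x₁, c₁), (x₂, c₂), (x₃, c₃)})
    (ℓ := fun p => if p.2 = c₁ then 1 else if p.2 = c₂ then m - k else m - 2 * k)
    (by simp [*]) (by grind [Set.InjOn]) (by simp [*, Ne.symm]) (by grind [Set.InjOn])
    (by grind)
  have hx₁ : g x₁ c₁ = 1 := by simpa using hP (x₁, c₁) (by simp)
  have hx₂ : g x₂ c₂ = m - k := by simpa [h₁₂.symm] using hP (x₂, c₂) (by simp)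
  have hx₃ : g x₃ c₃ = m - 2 * k := by
    simpa [h₁₃.symm, h₂₃.symm] using hP (x₃, c₃) (by simp)
  have hy₁ : m < g y₁ c₁ + k := hR (y₁, c₁) (by simp)
  have hy₂ : m < g y₂ c₂ + k := hR (y₂, c₂) (by simp)
  have hy₃ : m < g y₃ c₃ + k := hR (y₃, c₃) (by simp)
  have hy₂m := hg.le_ncard_edgeSet y₂ c₂
  have hy₃m := hg.le_ncard_edgeSet y₃ c₃
  have hy₂₃ : g y₂ c₂ ≠ g y₃ c₃ := fun h =>
    h₂₃ (congrArg Prod.snd (hg.arc_eq_of_label_eq hS₂.2.1 h₂.2 h))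
  refine ⟨g, hg, ?_, ?_, ?_⟩ <;> simp only [gap] <;> omega

theorem IsIndepDominating.exists_isSpread_isSwapOptimal (hS : IsIndepDominating G S)
    {x₁ y₁ x₂ y₂ x₃ y₃ c₁ c₂ c₃ : V} (hc : [c₁, c₂, c₃].Nodup)
    (hS₁ : x₁ ∈ S ∧ y₁ ∈ S ∧ x₁ ≠ y₁) (hS₂ : x₂ ∈ S ∧ y₂ ∈ S ∧ x₂ ≠ y₂)
    (hS₃ : x₃ ∈ S ∧ y₃ ∈ S ∧ x₃ ≠ y₃) (h₁ : G.Adj x₁ c₁ ∧ G.Adj y₁ c₁)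
    (h₂ : G.Adj x₂ c₂ ∧ G.Adj y₂ c₂) (h₃ : G.Adj x₃ c₃ ∧ G.Adj y₃ c₃)
    (hm : 6 * Sᶜ.card ≤ G.edgeSet.ncard) :
    ∃ g, IsAntimagicOutside G S g ∧
      IsSpread (gap g c₁ x₁ y₁) (gap g c₂ x₂ y₂) (gap g c₃ x₃ y₃) ∧
      IsSwapOptimal g c₁ x₁ y₁ ∧ IsSwapOptimal g c₂ x₂ y₂ ∧ IsSwapOptimal g c₃ x₃ y₃ := by
  obtain ⟨g, hg, hspread, hopt⟩ :=
    exists_isSwapOptimal (hS.exists_isSpread hc hS₁ hS₂ hS₃ h₁ h₂ h₃ hm)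
  obtain ⟨⟨h₁₂, h₁₃⟩, h₂₃⟩ : (c₁ ≠ c₂ ∧ c₁ ≠ c₃) ∧ c₂ ≠ c₃ := by simpa using hc
  refine ⟨g, hg, hspread, hopt c₁ x₁ hS₁.1 y₁ hS₁.2.1 h₁.1 h₁.2 ?_,
    hopt c₂ x₂ hS₂.1 y₂ hS₂.2.1 h₂.1 h₂.2 ?_, hopt c₃ x₃ hS₃.1 y₃ hS₃.2.1 h₃.1 h₃.2 ?_⟩
  · rw [gap_swapInto, gap_permuteInto_of_ne h₁₂.symm, gap_permuteInto_of_ne h₁₃.symm]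
    exact hspread.neg_left
  · rw [gap_swapInto, gap_permuteInto_of_ne h₁₂, gap_permuteInto_of_ne h₂₃.symm]
    exact hspread.neg_middle
  · rw [gap_swapInto, gap_permuteInto_of_ne h₁₃, gap_permuteInto_of_ne h₂₃]
    exact hspread.neg_right

theorem hasAntimagicOrientation_of_path {x y z w c₁ c₂ c₃ : V} (hxyzw : [x, y, z, w].Nodup)
    (hS : IsIndepDominating G {x, y, z, w}) (hc : [c₁, c₂, c₃].Nodup)
    (h₁ : G.Adj x c₁ ∧ G.Adj y c₁) (h₂ : G.Adj y c₂ ∧ G.Adj z c₂)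
    (h₃ : G.Adj z c₃ ∧ G.Adj w c₃)
    (hm : 6 * ({x, y, z, w} : Finset V)ᶜ.card ≤ G.edgeSet.ncard) :
    G.HasAntimagicOrientation := by
  obtain ⟨⟨hxy, hxz, hxw⟩, ⟨hyz, hyw⟩, hzw⟩ := nodup_quadruple.1 hxyzw
  obtain ⟨g, hg, hspread, k₁, k₂, k₃⟩ := hS.exists_isSpread_isSwapOptimal hc
    (by simp [hxy]) (by simp [hyz]) (by simp [hzw]) h₁ h₂ h₃ hm
  have hg₂ := hg.swapInto (by simp) (by simp) h₂.1 h₂.2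
  have hg₃ := hg.swapInto (by simp) (by simp) h₃.1 h₃.2
  have hg₂₃ := hg₂.swapInto (by simp) (by simp) h₃.1 h₃.2
  have hc₃₂ : c₃ ≠ c₂ := by grind
  rcases nodup_of_path_swaps hspread k₁ k₂ k₃ with h | h | h | h
  · exact hg.hasAntimagicOrientation_of_nodup (l := [x, y, z, w]) (by simp) (by simpa using h)
  · refine hg₂.hasAntimagicOrientation_of_nodup (l := [x, y, z, w]) (by simp) ?_
    simpa [netSum_swapInto_left, netSum_swapInto_right, netSum_swapInto_of_ne, hxy, hxz, hyw.symm,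
      hzw.symm] using h
  · refine hg₃.hasAntimagicOrientation_of_nodup (l := [x, y, z, w]) (by simp) ?_
    simpa [netSum_swapInto_left, netSum_swapInto_right, netSum_swapInto_of_ne, hxz, hxw, hyz,
      hyw] using h
  · refine hg₂₃.hasAntimagicOrientation_of_nodup (l := [x, y, z, w]) (by simp) ?_
    simpa [netSum_swapInto_left, netSum_swapInto_right, netSum_swapInto_of_ne,
      gap_permuteInto_of_ne, hxy, hxz, hxw, hyz, hyw, hyw.symm, hzw.symm, hc₃₂] using h

theorem hasAntimagicOrientation_of_star {x y z w c₁ c₂ c₃ : V} (hxyzw : [x, y, z, w].Nodup)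
    (hS : IsIndepDominating G {x, y, z, w}) (hc : [c₁, c₂, c₃].Nodup)
    (h₁ : G.Adj x c₁ ∧ G.Adj y c₁) (h₂ : G.Adj x c₂ ∧ G.Adj z c₂)
    (h₃ : G.Adj x c₃ ∧ G.Adj w c₃)
    (hm : 6 * ({x, y, z, w} : Finset V)ᶜ.card ≤ G.edgeSet.ncard) :
    G.HasAntimagicOrientation := by
  obtain ⟨⟨hxy, hxz, hxw⟩, ⟨hyz, hyw⟩, hzw⟩ := nodup_quadruple.1 hxyzw
  obtain ⟨⟨hc₁₂, hc₁₃⟩, hc₂₃⟩ : (c₁ ≠ c₂ ∧ c₁ ≠ c₃) ∧ c₂ ≠ c₃ := by simpa using hc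
  obtain ⟨g, hg, hspread, k₁, k₂, k₃⟩ := hS.exists_isSpread_isSwapOptimal hc
    (by simp [hxy]) (by simp [hxz]) (by simp [hxw]) h₁ h₂ h₃ hm
  have hg₁ := hg.swapInto (by simp) (by simp) h₁.1 h₁.2
  have hg₂ := hg.swapInto (by simp) (by simp) h₂.1 h₂.2
  have hg₃ := hg.swapInto (by simp) (by simp) h₃.1 h₃.2
  have hg₂₃ := hg₂.swapInto (by simp) (by simp) h₃.1 h₃.2
  have hg₁₃ := hg₁.swapInto (by simp) (by simp) h₃.1 h₃.2
  have hg₁₂ := hg₁.swapInto (by simp) (by simp) h₂.1 h₂.2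
  rcases nodup_of_star_swaps hspread k₁ k₂ k₃ with h | h | h | h | h | h
  · exact hg.hasAntimagicOrientation_of_nodup (l := [x, y, z, w]) (by simp) (by simpa using h)
  · refine hg₂.hasAntimagicOrientation_of_nodup (l := [x, y, z, w]) (by simp) ?_
    simpa [netSum_swapInto_left, netSum_swapInto_right, netSum_swapInto_of_ne, hxy.symm, hyz,
      hxw.symm, hzw.symm] using h
  · refine hg₃.hasAntimagicOrientation_of_nodup (l := [x, y, z, w]) (by simp) ?_
    simpa [netSum_swapInto_left, netSum_swapInto_right, netSum_swapInto_of_ne, hxy.symm, hyw,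
      hxz.symm, hzw] using h
  · refine hg₂₃.hasAntimagicOrientation_of_nodup (l := [x, y, z, w]) (by simp) ?_
    simpa [netSum_swapInto_left, netSum_swapInto_right, netSum_swapInto_of_ne,
      gap_permuteInto_of_ne, hxy.symm, hyz, hyw, hxz.symm, hzw, hxw.symm, hzw.symm,
      hc₂₃.symm] using h
  · refine hg₁₃.hasAntimagicOrientation_of_nodup (l := [x, y, z, w]) (by simp) ?_
    simpa [netSum_swapInto_left, netSum_swapInto_right, netSum_swapInto_of_ne,
      gap_permuteInto_of_ne, hxy.symm, hyw, hxz.symm, hyz.symm, hzw, hxw.symm, hyw.symm,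
      hc₁₃.symm] using h
  · refine hg₁₂.hasAntimagicOrientation_of_nodup (l := [x, y, z, w]) (by simp) ?_
    simpa [netSum_swapInto_left, netSum_swapInto_right, netSum_swapInto_of_ne,
      gap_permuteInto_of_ne, hxy.symm, hyz, hxz.symm, hyz.symm, hxw.symm, hyw.symm, hzw.symm,
      hc₁₂.symm] using h

theorem hasAntimagicOrientation_of_netSum_eq {g : V → V → ℕ} {u v w y c d : V}
    (hg : IsAntimagicOutside G {u, v, w, y} g) (huvwy : [u, v, w, y].Nodup)
    (hc : ∀ s ∈ ({u, v, w} : Finset V), G.Adj s c)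
    (hgap : ∀ s ∈ ({u, v, w} : Finset V), ∀ t ∈ ({u, v, w} : Finset V),
      2 * (gap g c s t).natAbs < (gap g d w y).natAbs)
    (hopt : ∀ s ∈ ({u, v, w} : Finset V), ∀ t ∈ ({u, v, w} : Finset V), IsSwapOptimal g c s t)
    (hopt_wy : IsSwapOptimal g d w y) (hyu : netSum g y = netSum g u) :
    G.HasAntimagicOrientation := by
  obtain ⟨⟨huv, huw, huy⟩, ⟨hvw, hvy⟩, hwy⟩ := nodup_quadruple.1 huvwy
  obtain ⟨huc, hvc, hwc⟩ : G.Adj u c ∧ G.Adj v c ∧ G.Adj w c := by simpa using hc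
  have hvw_eq : gap g c v w = gap g c u w - gap g c u v := by
    simp only [gap]
    ring
  have hg_uv := hg.swapInto (by simp) (by simp) huc hvc
  have hg_uw := hg.swapInto (by simp) (by simp) huc hwc
  have hg_uw_vw := hg_uw.swapInto (by simp) (by simp) hvc hwc
  have hgap_vw : gap (swapInto g c u w) c v w = -gap g c u v := by
    simp [gap, Equiv.swap_apply_of_ne_of_ne huv.symm hvw]
  rcases nodup_of_triple_swaps (Int.natAbs_pos.2 (hg.gap_ne_zero (by simp) huc huv))
    (Int.natAbs_pos.2 (hg.gap_ne_zero (by simp) huc huw))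
    (hvw_eq ▸ Int.natAbs_pos.2 (hg.gap_ne_zero (by simp) hvc hvw)) (hgap u (by simp) v (by simp))
    (hgap u (by simp) w (by simp)) (hvw_eq ▸ hgap v (by simp) w (by simp))
    (hopt u (by simp) v (by simp)) (hopt u (by simp) w (by simp))
    (hvw_eq ▸ hopt v (by simp) w (by simp)) (hyu ▸ hopt_wy) with h | h | h
  · refine hg_uw.hasAntimagicOrientation_of_nodup (l := [u, v, w, y]) (by simp) ?_
    simpa [netSum_swapInto_left, netSum_swapInto_right, netSum_swapInto_of_ne, huv.symm, hvw,
      huy.symm, hwy.symm, hyu] using h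
  · refine hg_uv.hasAntimagicOrientation_of_nodup (l := [u, v, w, y]) (by simp) ?_
    simpa [netSum_swapInto_left, netSum_swapInto_right, netSum_swapInto_of_ne, huw.symm, hvw.symm,
      huy.symm, hvy.symm, hyu] using h
  · refine hg_uw_vw.hasAntimagicOrientation_of_nodup (l := [u, v, w, y]) (by simp) ?_
    simpa [netSum_swapInto_left, netSum_swapInto_right, netSum_swapInto_of_ne, hgap_vw, huv, huw,
      huv.symm, hvw, huy.symm, hvy.symm, hwy.symm, hyu, ← sub_eq_add_neg] using h

theorem IsIndepDominating.exists_gap_lt (hS : IsIndepDominating G S) {u v w y c d : V}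
    (huvw : [u, v, w].Nodup) (hwy : w ≠ y) (hcd : c ≠ d) (huS : u ∈ S) (hvS : v ∈ S)
    (hwS : w ∈ S) (hyS : y ∈ S) (hc : ∀ s ∈ ({u, v, w} : Finset V), G.Adj s c)
    (hwd : G.Adj w d) (hyd : G.Adj y d) (hm : 6 * Sᶜ.card ≤ G.edgeSet.ncard) :
    ∃ g, IsAntimagicOutside G S g ∧ ∀ s ∈ ({u, v, w} : Finset V), ∀ t ∈ ({u, v, w} : Finset V),
      2 * (gap g c s t).natAbs < (gap g d w y).natAbs := by
  have hc' : G.Adj u c ∧ G.Adj v c ∧ G.Adj w c := by simpa using hc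
  obtain ⟨⟨huv, huw⟩, hvw⟩ : (u ≠ v ∧ u ≠ w) ∧ v ≠ w := by simpa using huvw
  have hk := hS.card_compl_pos huS hc'.1
  set k := Sᶜ.card
  set m := G.edgeSet.ncard
  obtain ⟨g, hg, hP, hR⟩ := hS.exists_isAntimagicOutside (R := {(w, c), (y, d)})
    (P := {(u, c), (v, c), (w, d)})
    (ℓ := fun p => if p.2 = d then 1 else if p.1 = u then m - k - 1 else m - k)
    (by simp [*]) (by grind [Set.InjOn]) (by simp [*, Ne.symm]) (by grind [Set.InjOn]) (by grind)
  have hwd₁ : g w d = 1 := by simpa using hP (w, d) (by simp)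
  have huc_eq : g u c = m - k - 1 := by simpa [hcd] using hP (u, c) (by simp)
  have hvc_eq : g v c = m - k := by simpa [hcd, huv.symm] using hP (v, c) (by simp)
  have hwck : m < g w c + k := hR (w, c) (by simp)
  have hydk : m < g y d + k := hR (y, d) (by simp)
  have hwcm := hg.le_ncard_edgeSet w c
  have hbounds : ∀ s ∈ ({u, v, w} : Finset V), m - k - 1 ≤ g s c ∧ g s c ≤ m := by
    simp only [Finset.mem_insert, Finset.mem_singleton, forall_eq_or_imp, forall_eq]
    omega
  refine ⟨g, hg, fun s hs t ht => ?_⟩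
  have hs := hbounds s hs
  have ht := hbounds t ht
  simp only [gap]
  omega

theorem hasAntimagicOrientation_of_triple {u v w y c d : V} (huvwy : [u, v, w, y].Nodup)
    (hS : IsIndepDominating G {u, v, w, y}) (hcd : c ≠ d)
    (hc : ∀ s ∈ ({u, v, w} : Finset V), G.Adj s c) (hwd : G.Adj w d) (hyd : G.Adj y d)
    (hm : 6 * ({u, v, w, y} : Finset V)ᶜ.card ≤ G.edgeSet.ncard) :
    G.HasAntimagicOrientation := by
  obtain ⟨⟨huv, huw, huy⟩, ⟨hvw, hvy⟩, hwy⟩ := nodup_quadruple.1 huvwy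
  obtain ⟨g, hg, hgap, hopt⟩ := exists_isSwapOptimal (hS.exists_gap_lt (by simp [*]) hwy hcd
    (by simp) (by simp) (by simp) (by simp) hc hwd hyd hm)
  have hT : ({u, v, w} : Finset V) ⊆ {u, v, w, y} := by
    grind
  have hopt_c : ∀ s ∈ ({u, v, w} : Finset V), ∀ t ∈ ({u, v, w} : Finset V),
      IsSwapOptimal g c s t := fun s hs t ht =>
    hopt c s (hT hs) t (hT ht) (hc s hs) (hc t ht) fun a ha b hb => by
      have hmaps {r : V} (hr : r ∈ ({u, v, w} : Finset V)) :
          Equiv.swap s t r ∈ ({u, v, w} : Finset V) := by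
        rw [Equiv.swap_apply_def]
        split_ifs <;> assumption
      simpa [gap, permuteInto_of_ne hcd.symm] using hgap _ (hmaps ha) _ (hmaps hb)
  have hopt_d : IsSwapOptimal g d w y := hopt d w (by simp) y (by simp) hwd hyd fun a ha b hb => by
    simpa [gap_swapInto, gap_permuteInto_of_ne hcd] using hgap a ha b hb
  by_cases hyu : netSum g y = netSum g u
  · exact hasAntimagicOrientation_of_netSum_eq hg huvwy hc hgap hopt_c hopt_d hyu
  by_cases hyv : netSum g y = netSum g v
  · rw [Finset.insert_comm] at hg hc hgap hopt_c
    exact hasAntimagicOrientation_of_netSum_eq hg (by grind) hc hgap hopt_c hopt_d hyv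
  have huv_ne := hg.netSum_ne (by simp) (hc u (by simp)) huv (hopt_c u (by simp) v (by simp))
  have huw_ne := hg.netSum_ne (by simp) (hc u (by simp)) huw (hopt_c u (by simp) w (by simp))
  have hvw_ne := hg.netSum_ne (by simp) (hc v (by simp)) hvw (hopt_c v (by simp) w (by simp))
  exact hg.hasAntimagicOrientation_of_nodup (l := [u, v, w, y]) (by simp) <| nodup_quadruple.2
    ⟨⟨huv_ne, huw_ne, Ne.symm hyu⟩, ⟨hvw_ne, Ne.symm hyv⟩, hg.netSum_ne (by simp) hwd hwy hopt_d⟩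

end Cases

section LinkTree

variable {V : Type*} {G : SimpleGraph V} {S : Finset V}

theorem Linked.symm {x y : V} (h : Linked G x y) : Linked G y x := by
  obtain ⟨c, hx, hy⟩ := h
  exact ⟨c, hy, hx⟩

theorem exists_linked_of_not_dominating (hG : G.Connected) (hne : S.Nonempty) {t : V}
    (ht : t ∉ S ∧ ∀ s ∈ S, ¬ G.Adj s t) :
    ∃ z, (z ∉ S ∧ ∀ s ∈ S, ¬ G.Adj s z) ∧ ∃ x ∈ S, Linked G x z := by
  obtain ⟨x, hx⟩ := hne
  obtain ⟨p⟩ := hG.preconnected t x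
  obtain ⟨e, -, hfst, hsnd⟩ := p.exists_boundary_dart {z | z ∉ S ∧ ∀ s ∈ S, ¬ G.Adj s z} ht
    fun h => h.1 hx
  have hsndS : e.snd ∉ S := fun h => hfst.2 _ h e.adj.symm
  obtain ⟨s, hs, hadj⟩ : ∃ s ∈ S, G.Adj s e.snd := by
    by_contra! h
    exact hsnd ⟨hsndS, h⟩
  exact ⟨e.fst, hfst, s, hs, e.snd, hadj, e.adj⟩

variable [DecidableEq V]

/-- The vertices of a finite set are joined by a tree whose edges are links, built up leaf by
leaf. -/
inductive LinkTree (G : SimpleGraph V) : Finset V → Prop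
  | singleton (x : V) : LinkTree G {x}
  | insert {S : Finset V} {x z : V} (hS : LinkTree G S) (hx : x ∈ S) (hz : z ∉ S)
      (hxz : Linked G x z) : LinkTree G (insert z S)

namespace LinkTree

theorem nonempty (h : LinkTree G S) : S.Nonempty := by
  cases h <;> simp

theorem pairwise_linked (h : LinkTree G S) (hcard : S.card ≤ 2) :
    (S : Set V).Pairwise (Linked G) := by
  cases h with
  | singleton => simp
  | @insert T x z hT hx hz hxz =>
    rw [Finset.card_insert_of_notMem hz, Nat.add_le_add_iff_right] at hcard
    obtain rfl : T = {x} := Finset.eq_singleton_iff_unique_mem.2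
      ⟨hx, fun y hy => Finset.card_le_one.1 hcard y hy x hx⟩
    simp [Set.pairwise_insert, hxz, hxz.symm]

theorem exists_triple (h : LinkTree G S) (hcard : S.card = 3) :
    ∃ x y z, S = {x, y, z} ∧ [x, y, z].Nodup ∧ Linked G x y ∧ Linked G y z := by
  cases h with
  | singleton => simp at hcard
  | @insert T x z hT hx hz hxz =>
    rw [Finset.card_insert_of_notMem hz, Nat.add_right_cancel_iff] at hcard
    obtain ⟨y, hy, hyx⟩ := Finset.exists_mem_ne (s := T) (by omega) x
    obtain rfl : {x, y} = T := Finset.eq_of_subset_of_card_le (by grind) (by grind)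
    exact ⟨z, x, y, rfl, by grind, hxz.symm, hT.pairwise_linked hcard.le hx hy hyx.symm⟩

theorem exists_path_or_star (h : LinkTree G S) (hcard : S.card = 4) :
    ∃ x y z w, S = {x, y, z, w} ∧ [x, y, z, w].Nodup ∧ Linked G x y ∧
      (Linked G y z ∧ Linked G z w ∨ Linked G x z ∧ Linked G x w) := by
  cases h with
  | singleton => simp at hcard
  | @insert T a w hT ha hw haw =>
    rw [Finset.card_insert_of_notMem hw, Nat.add_right_cancel_iff] at hcard
    obtain ⟨x, y, z, rfl, hxyz, hxy, hyz⟩ := hT.exists_triple hcard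
    obtain rfl | rfl | rfl : a = x ∨ a = y ∨ a = z := by simpa using ha
    · exact ⟨w, a, y, z, rfl, by grind, haw.symm, Or.inl ⟨hxy, hyz⟩⟩
    · exact ⟨a, x, z, w, by grind, by grind, hxy.symm, Or.inr ⟨hyz, haw⟩⟩
    · exact ⟨x, y, a, w, by grind, by grind, hxy, Or.inl ⟨hyz, haw⟩⟩

end LinkTree

theorem exists_isIndepDominating_linkTree [Finite V] (hG : G.Connected) :
    ∃ S, IsIndepDominating G S ∧ LinkTree G S := by
  have := Fintype.ofFinite V
  obtain ⟨x⟩ := hG.nonempty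
  obtain ⟨S, hS⟩ := (Set.toFinite {S : Finset V | G.IsIndepSet S ∧ LinkTree G S}).exists_maximal
    ⟨{x}, by simp, .singleton x⟩
  obtain ⟨hindep, htree⟩ := hS.prop
  refine ⟨S, ⟨hindep, fun t ht => ?_⟩, htree⟩
  by_contra! hdom
  obtain ⟨z, ⟨hz, hzS⟩, y, hy, hyz⟩ :=
    exists_linked_of_not_dominating hG htree.nonempty ⟨ht, hdom⟩
  have hindep' : G.IsIndepSet (insert z S : Finset V) := by
    rw [IsIndepSet, Finset.coe_insert, Set.pairwise_insert]
    exact ⟨hindep, fun s hs _ => ⟨fun h => hzS s hs h.symm, hzS s hs⟩⟩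
  exact hz (hS.le_of_ge ⟨hindep', htree.insert hy hz hyz⟩ (Finset.subset_insert z S)
    (Finset.mem_insert_self z S))

end LinkTree

section FewVertices

variable {V : Type*} [Fintype V] [DecidableEq V] {G : SimpleGraph V} {S : Finset V}

omit [DecidableEq V] in
theorem IsIndepDominating.hasAntimagicOrientation_of_common_adj (hS : IsIndepDominating G S)
    {c : V} (hc : ∀ s ∈ S, G.Adj s c) : G.HasAntimagicOrientation :=
  hS.hasAntimagicOrientation_of_pairwise_linked fun x hx y hy _ => ⟨c, hc x hx, hc y hy⟩

theorem IsIndepDominating.hasAntimagicOrientation_of_common_adj_three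
    (hS : IsIndepDominating G S) {u v w y c : V} (hSeq : S = {u, v, w, y})
    (huvwy : [u, v, w, y].Nodup) (hc : ∀ s ∈ ({u, v, w} : Finset V), G.Adj s c)
    (hwy : Linked G w y) (hm : 6 * Sᶜ.card ≤ G.edgeSet.ncard) : G.HasAntimagicOrientation := by
  subst hSeq
  by_cases hyc : G.Adj y c
  · exact hS.hasAntimagicOrientation_of_common_adj (c := c) (by simpa [hyc, and_assoc] using hc)
  · obtain ⟨d, hwd, hyd⟩ := hwy
    exact hasAntimagicOrientation_of_triple huvwy hS (by rintro rfl; exact hyc hyd) hc hwd hyd hm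

theorem IsIndepDominating.hasAntimagicOrientation_of_linked_path (hS : IsIndepDominating G S)
    {x y z w : V} (hSeq : S = {x, y, z, w}) (hxyzw : [x, y, z, w].Nodup) (hxy : Linked G x y)
    (hyz : Linked G y z) (hzw : Linked G z w) (hm : 6 * Sᶜ.card ≤ G.edgeSet.ncard) :
    G.HasAntimagicOrientation := by
  obtain ⟨c₁, hxc₁, hyc₁⟩ := id hxy
  obtain ⟨c₂, hyc₂, hzc₂⟩ := id hyz
  obtain ⟨c₃, hzc₃, hwc₃⟩ := id hzw
  by_cases hz : G.Adj z c₁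
  · exact hS.hasAntimagicOrientation_of_common_adj_three hSeq hxyzw (c := c₁)
      (by simp [*]) hzw hm
  by_cases hw : G.Adj w c₂
  · exact hS.hasAntimagicOrientation_of_common_adj_three (u := z) (v := w) (w := y) (y := x)
      (c := c₂) (by grind) (by grind) (by simp [*]) hxy.symm hm
  subst hSeq
  exact hasAntimagicOrientation_of_path hxyzw hS (c₁ := c₁) (c₂ := c₂) (c₃ := c₃) (by grind)
    ⟨hxc₁, hyc₁⟩ ⟨hyc₂, hzc₂⟩ ⟨hzc₃, hwc₃⟩ hm

theorem IsIndepDominating.hasAntimagicOrientation_of_linked_star (hS : IsIndepDominating G S)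
    {x y z w : V} (hSeq : S = {x, y, z, w}) (hxyzw : [x, y, z, w].Nodup) (hxy : Linked G x y)
    (hxz : Linked G x z) (hxw : Linked G x w) (hm : 6 * Sᶜ.card ≤ G.edgeSet.ncard) :
    G.HasAntimagicOrientation := by
  obtain ⟨c₁, hxc₁, hyc₁⟩ := id hxy
  obtain ⟨c₂, hxc₂, hzc₂⟩ := id hxz
  obtain ⟨c₃, hxc₃, hwc₃⟩ := id hxw
  by_cases hz : G.Adj z c₁
  · exact hS.hasAntimagicOrientation_of_common_adj_three (u := y) (v := z) (w := x) (y := w)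
      (c := c₁) (by grind) (by grind) (by simp [*]) hxw hm
  by_cases hw₁ : G.Adj w c₁
  · exact hS.hasAntimagicOrientation_of_common_adj_three (u := y) (v := w) (w := x) (y := z)
      (c := c₁) (by grind) (by grind) (by simp [*]) hxz hm
  by_cases hw₂ : G.Adj w c₂
  · exact hS.hasAntimagicOrientation_of_common_adj_three (u := z) (v := w) (w := x) (y := y)
      (c := c₂) (by grind) (by grind) (by simp [*]) hxy hm
  subst hSeq
  exact hasAntimagicOrientation_of_star hxyzw hS (c₁ := c₁) (c₂ := c₂) (c₃ := c₃) (by grind)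
    ⟨hxc₁, hyc₁⟩ ⟨hxc₂, hzc₂⟩ ⟨hxc₃, hwc₃⟩ hm

theorem IsIndepDominating.hasAntimagicOrientation_of_card_eq_three (hS : IsIndepDominating G S)
    (hT : LinkTree G S) (hcard : S.card = 3) (hm : 2 * Sᶜ.card < G.edgeSet.ncard) :
    G.HasAntimagicOrientation := by
  obtain ⟨x, y, z, rfl, hxyz, ⟨c, hxc, hyc⟩, d, hyd, hzd⟩ := hT.exists_triple hcard
  by_cases hzc : G.Adj z c
  · exact hS.hasAntimagicOrientation_of_common_adj (c := c) (by simp [*])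
  · exact hasAntimagicOrientation_of_three hxyz hS (by rintro rfl; exact hzc hzd) hxc hyc hyd hzd hm

theorem IsIndepDominating.hasAntimagicOrientation_of_card_eq_four (hS : IsIndepDominating G S)
    (hT : LinkTree G S) (hcard : S.card = 4) (hm : 6 * Sᶜ.card ≤ G.edgeSet.ncard) :
    G.HasAntimagicOrientation := by
  obtain ⟨x, y, z, w, hSeq, hxyzw, hxy, h⟩ := hT.exists_path_or_star hcard
  obtain ⟨hyz, hzw⟩ | ⟨hxz, hxw⟩ := h
  · exact hS.hasAntimagicOrientation_of_linked_path hSeq hxyzw hxy hyz hzw hm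
  · exact hS.hasAntimagicOrientation_of_linked_star hSeq hxyzw hxy hxz hxw hm

omit [DecidableEq V] in
theorem hasAntimagicOrientation_of_indepNum_le_four (hG : G.Connected) (hα : G.indepNum ≤ 4)
    (h₃ : 3 ≤ G.indepNum → 2 * (Fintype.card V - 3) < G.edgeSet.ncard)
    (h₄ : 4 ≤ G.indepNum → 6 * (Fintype.card V - 4) ≤ G.edgeSet.ncard) :
    G.HasAntimagicOrientation := by
  classical
  obtain ⟨S, hS, hT⟩ := exists_isIndepDominating_linkTree hG
  have hcard := hS.isIndepSet.card_le_indepNum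
  obtain h | h | h : S.card ≤ 2 ∨ S.card = 3 ∨ S.card = 4 := by omega
  · exact hS.hasAntimagicOrientation_of_pairwise_linked (hT.pairwise_linked h)
  · refine hS.hasAntimagicOrientation_of_card_eq_three hT h ?_
    rw [Finset.card_compl, h]
    exact h₃ (h ▸ hcard)
  · refine hS.hasAntimagicOrientation_of_card_eq_four hT h ?_
    rw [Finset.card_compl, h]
    exact h₄ (h ▸ hcard)

end FewVertices

section EdgeBounds

variable {V : Type*} [Fintype V]

theorem minDegree_mul_card_le_two_mul_ncard_edgeSet (G : SimpleGraph V) [DecidableRel G.Adj] :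
    G.minDegree * Fintype.card V ≤ 2 * G.edgeSet.ncard := by
  classical
  rw [← coe_edgeFinset, Set.ncard_coe_finset, ← sum_degrees_eq_twice_card_edges, mul_comm]
  exact Finset.card_nsmul_le_sum _ _ _ fun v _ => G.minDegree_le_degree v

theorem ncard_edgeSet_add_ncard_edgeSet_compl (G : SimpleGraph V) :
    G.edgeSet.ncard + Gᶜ.edgeSet.ncard = (Fintype.card V).choose 2 := by
  classical
  rw [← card_edgeFinset_top_eq_card_choose_two, ← Set.ncard_coe_finset, coe_edgeFinset,
    ← sup_compl_eq_top (x := G), edgeSet_sup, Set.ncard_union_eq]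
  rw [disjoint_edgeSet]
  exact disjoint_compl_right

/-- Turán's theorem, applied to the complement. -/
theorem card_mul_sub_le_mul_ncard_edgeSet (G : SimpleGraph V) {r : ℕ} (hr : 0 < r)
    (hα : G.indepNum ≤ r) :
    Fintype.card V * (Fintype.card V - r) ≤ 2 * r * G.edgeSet.ncard := by
  classical
  have hfree : Gᶜ.CliqueFree (r + 1) := fun s hs => by
    rw [isNClique_compl] at hs
    have := hs.isIndepSet.card_le_indepNum
    have := hs.card_eq
    omega
  have hturan : 2 * r * Gᶜ.edgeSet.ncard ≤ (r - 1) * Fintype.card V ^ 2 := by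
    rw [← coe_edgeFinset, Set.ncard_coe_finset]
    refine (Nat.mul_le_mul_left _ ?_).trans (mul_card_edgeFinset_turanGraph_le (r := r))
    rw [card_edgeFinset_turanGraph]
    exact hfree.card_edgeFinset_le
  have hsum := ncard_edgeSet_add_ncard_edgeSet_compl G
  rcases le_total (Fintype.card V) r with hn | hn
  · simp [Nat.sub_eq_zero_of_le hn]
  · rify [hn, hr] at hturan hsum ⊢
    rw [Nat.cast_choose_two] at hsum
    linear_combination hturan - 2 * r * hsum

end EdgeBounds

end AntimagicOrientation

theorem theorem1p5 {V : Type*} [Fintype V] (G : SimpleGraph V) [DecidableRel G.Adj]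
    (hG : G.Connected) :
    (G.indepNum ≤ 2 → G.HasAntimagicOrientation) ∧
    (G.indepNum = 3 → 13 ≤ Fintype.card V → G.HasAntimagicOrientation) ∧
    (G.indepNum = 4 → 11 ≤ G.minDegree → G.HasAntimagicOrientation) := by
  open AntimagicOrientation in
  refine ⟨fun hα => ?_, fun hα hV => ?_, fun hα hδ => ?_⟩
  · exact hasAntimagicOrientation_of_indepNum_le_four hG (by omega) (by omega) (by omega)
  · have hedges := card_mul_sub_le_mul_ncard_edgeSet G three_pos hα.le
    refine hasAntimagicOrientation_of_indepNum_le_four hG (by omega) (fun _ => ?_) (by omega)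
    have := Nat.mul_le_mul_right (Fintype.card V - 3) hV
    omega
  · have hturan := card_mul_sub_le_mul_ncard_edgeSet G four_pos hα.le
    have hdegree := (Nat.mul_le_mul_right _ hδ).trans
      (minDegree_mul_card_le_two_mul_ncard_edgeSet G)
    have hedges : 6 * (Fintype.card V - 4) ≤ G.edgeSet.ncard := by
      rcases le_total (Fintype.card V) 48 with hV | hV
      · omega
      · have := Nat.mul_le_mul_right (Fintype.card V - 4) hV
        omega
    have hV : 0 < Fintype.card V := Fintype.card_pos_iff.2 hG.nonempty
    exact hasAntimagicOrientation_of_indepNum_le_four hG hα.le (by omega) fun _ => hedges
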